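/- Let $m\ge 0$, $N=2^m$, and call the products of distinct variables among $x_1,\dots,x_m$ monomials. A monomial with exponents $(a_1,\dots,a_m)\in\{0,1\}^m$ has index $D(a)=1+\sum_{k}2^{k-1}(a_k\oplus 1)\in\{1,\dots,N\}$; a polynomial $p$ over $\mathbb F_2$ is identified with its evaluation vector in $\mathbb F_2^N$, whose entry in position $D(a)$ is $p(a)$. Order the monomials by $x_{i_1}\cdots x_{i_t}\preccurlyeq x_{j_1}\cdots x_{j_s}$ ($i_1<\dots<i_t$, $j_1<\dots<j_s$) iff $t\le s$ and $i_{t-l}\le j_{s-l}$ for $0\le l<t$. Let $\mathcal I$ be a nonempty set of monomials that is decreasing (closed downwards under $\preccurlyeq$), let $r$ be the maximal degree in $\mathcal I$, and let $C(\mathcal I)$ be the span of the monomials in $\mathcal I$. Let $X_i=\{1,\dots,i\}$ be the quasi-uniform puncturing pattern, and assume that no monomial of $\mathcal I$ has its index in $X_i$ (punctured monomials are frozen). Let $C_P(\mathcal I,X_i)$ be the set of the codewords of $C(\mathcal I)$ restricted to the positions outside $X_i$. For $f\in\mathcal I$ let $T(f)$ be the set of the codewords $p=\sum_{g\in\mathcal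 I}u_g g$ with $u_f=1$, with $u_g=0$ whenever $g$ has smaller index than $f$, and with $\operatorname{wt}(p)=\operatorname{wt}(f)=2^{m-\deg f}$; let $T_P(f,X_i)$ be the set of the restrictions of these words to the positions outside $X_i$, and $P_f(w,i)$ the number of words of weight $w$ in $T_P(f,X_i)$. Let $A_w$ be the number of words of weight $w$ in $C_P(\mathcal I,X_i)$. Then there is a least positive integer $d$ with $\sum_{f\in\mathcal I}P_f(d,i)>0$, and: 1. $d$ is the minimum weight of the nonzero words of $C_P(\mathcal I,X_i)$, and every word of weight $d$ in $C_P(\mathcal I,X_i)$ lies in $T_P(f,X_i)$ for some $f\in\mathcal I$; 2. $A_d=\sum_{f\in\mathcal I}P_f(d,i)$; 3. $A_w\ge\sum_{f\in\mathcal I}P_f(w,i)$ for all $w>d$; 4. for every $f\in\mathcal I$ such that no monomial of $\mathcal I$ of larger index than $f$ has larger degree than $f$ (in particular for every $f\in\mathcal I$ of degree $r$), and all $w\ge 0$, $P_f(w,i)=N_f(2^{m-\deg f}-w,\,i)$, where $N_f(w,a)$ ($w\in\mathbb Z$, $a\ge 0$) is computed recursively as follows. If $f=x_{i_1}\cdots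 x_{i_t}$ with $i_1<\dots<i_t$ and $t\ge 2$, let $B$ be the set of the $s<i_t$ such that $x_s$ does not divide $f$, let $\alpha_f(s)=|\{j\le t-1: i_j>s\}|$, $f^{(0)}=x_{i_1}\cdots x_{i_{t-1}}$, $f^{(s)}=f^{(0)}x_s$, and $\lambda_f=2^{\sum_{l=1}^t(i_l-l+1)}$; then $$N_f(w,a)=\begin{cases}\sum_{s\in B}2^{\alpha_f(s)}N_{f^{(s)}}(w,a)+N_{f^{(0)}}(w,a), & a\le 2^{i_t-1},\ w\ne 0,\\ \lambda_f-\sum_{v=1}^{2^{m-t}}N_f(v,a), & a\le 2^{i_t-1},\ w=0,\\ N_f(2^{i_t-t}-w,\,2^{i_t}-a), & 2^{i_t-1}<a\le 2^{i_t},\\ N_f(w-2^{i_t-t},\,a-2^{i_t}), & a>2^{i_t}.\end{cases}$$ If $t=\deg f\le 1$, then $N_f(w,a)$ is the number, found by exhaustive search, of the words of weight $w$ on the first $a$ positions in the set $T(f)$ taken for the code spanned by all monomials of degree at most $t$. -/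

import Mathlib

namespace QUPPolar

open Finset

/-- A monomial in `x_1, …, x_m` with exponents in `{0, 1}`, given by the set of its variables;
the element `k : Fin m` stands for the variable `x_{k+1}`. Its degree is its cardinality. -/
abbrev Monomial (m : ℕ) := Finset (Fin m)

/-- Words of length `N = 2 ^ m`. The coordinate `l` is the position `l + 1` among `1, …, N`. -/
abbrev Word (m : ℕ) := Fin (2 ^ m) → ZMod 2

/-- The value of the variable `x_{k+1}` at the evaluation point of the coordinate `l`: the position
`z = l + 1` is `1 + ∑ k, 2 ^ k * (x_{k+1} ⊕ 1)`, so that `x_{k+1}` is the complement of the `k`-th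
binary digit of `l`. -/
def varAt {m : ℕ} (l : Fin (2 ^ m)) (k : Fin m) : ZMod 2 :=
  if l.val.testBit k.val then 0 else 1

/-- The evaluation vector of a monomial (a row of the `m`-th Kronecker power of
`[[1, 0], [1, 1]]`). -/
def evMon {m : ℕ} (f : Monomial m) : Word m := fun l => ∏ k ∈ f, varAt l k

/-- The evaluation vector of the polynomial `∑ f, u f • f`. -/
def ev {m : ℕ} (u : Monomial m → ZMod 2) : Word m := fun l => ∑ f, u f * evMon f l

/-- The index `D(a_1, …, a_m) = 1 + ∑ k, 2 ^ (k - 1) * (a_k ⊕ 1)` in `{1, …, 2 ^ m}` of the monomial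
with exponents `a_1, …, a_m`. -/
def index {m : ℕ} (f : Monomial m) : ℕ :=
  (∑ k : Fin m, if k ∈ f then 0 else 2 ^ k.val) + 1

/-- The partial order on monomials: `f ≼ g` if `g` has a factor `g'` of the same degree as `f` such
that the `l`-th smallest variable of `f` does not exceed that of `g'`, for every `l`. -/
def Precedes {m : ℕ} (f g : Monomial m) : Prop :=
  ∃ g' : Monomial m, g' ⊆ g ∧ ∃ h : g'.card = f.card,
    ∀ l : Fin f.card, f.orderEmbOfFin rfl l ≤ g'.orderEmbOfFin h l

/-- Decreasing information sets. -/
def IsDecreasing {m : ℕ} (I : Finset (Monomial m)) : Prop :=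
  ∀ f g : Monomial m, Precedes f g → g ∈ I → f ∈ I

/-- The monomial code of `I` is of `r`-th order: `r` is the maximum degree of a monomial in `I`. -/
def HasOrder {m : ℕ} (I : Finset (Monomial m)) (r : ℕ) : Prop :=
  IsGreatest {t : ℕ | ∃ f ∈ I, f.card = t} r

/-- The polar (monomial) code `C(I)`, the span of the evaluations of the monomials in `I`. -/
def code {m : ℕ} (I : Finset (Monomial m)) : Submodule (ZMod 2) (Word m) :=
  Submodule.span (ZMod 2) (evMon '' (I : Set (Monomial m)))

/-- `T(f)` for the code `C(I)`: the codewords of `C(I)` in whose expansion `f` is the monomial of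
smallest index and which have the same weight as `f`. -/
def T {m : ℕ} (I : Finset (Monomial m)) (f : Monomial m) : Set (Word m) :=
  {p | ∃ u : Monomial m → ZMod 2,
    (∀ g, index g < index f → u g = 0) ∧ u f = 1 ∧ (∀ g, g ∉ I → u g = 0) ∧
    p = ev u ∧ hammingNorm p = hammingNorm (evMon f)}

/-- The quasi-uniform puncturing pattern `X_i`: the positions `1, …, i`. -/
def qup (m i : ℕ) : Finset (Fin (2 ^ m)) := univ.filter fun l => l.val + 1 ≤ i

/-- A word restricted to the positions outside of `X`. -/
def puncture {m : ℕ} (X : Finset (Fin (2 ^ m))) (c : Word m) : {l // l ∉ X} → ZMod 2 :=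
  fun l => c l.val

/-- The punctured code `C_P(I, X)`. -/
def puncturedCode {m : ℕ} (I : Finset (Monomial m)) (X : Finset (Fin (2 ^ m))) :
    Set ({l // l ∉ X} → ZMod 2) :=
  puncture X '' (code I : Set (Word m))

/-- `T_P(f, X)`: the words of `T(f)`, punctured. -/
def puncturedT {m : ℕ} (I : Finset (Monomial m)) (f : Monomial m) (X : Finset (Fin (2 ^ m))) :
    Set ({l // l ∉ X} → ZMod 2) :=
  puncture X '' T I f

/-- The number `A_w(S)` of words of weight `w` in `S`. -/
noncomputable def numWeight {ι : Type} [Fintype ι] (S : Set (ι → ZMod 2)) (w : ℕ) : ℕ :=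
  {c | c ∈ S ∧ hammingNorm c = w}.ncard

/-- `d` is the minimum weight of `S`: the least weight of a nonzero word in `S`. -/
def IsMinWeight {ι : Type} [Fintype ι] (S : Set (ι → ZMod 2)) (d : ℕ) : Prop :=
  IsLeast {w : ℕ | ∃ c ∈ S, c ≠ 0 ∧ hammingNorm c = w} d

/-- `P_f(w, i)`: the number of words of weight `w` in `T_P(f, X_i)`. -/
noncomputable def P {m : ℕ} (I : Finset (Monomial m)) (f : Monomial m) (w i : ℕ) : ℕ :=
  numWeight (puncturedT I f (qup m i)) w

/-- The weight of the first `a` entries of a word. -/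
def prefixWeight {m : ℕ} (a : ℕ) (c : Word m) : ℕ :=
  (univ.filter fun l : Fin (2 ^ m) => l.val + 1 ≤ a ∧ c l ≠ 0).card

/-- `λ_f = 2 ^ ∑ l, (i_l - l + 1)` for `f = x_{i_1} ⋯ x_{i_t}`, `i_1 < ⋯ < i_t`. -/
def lam {m : ℕ} (f : Monomial m) : ℕ :=
  2 ^ ∑ l : Fin f.card, ((f.orderEmbOfFin rfl l).val - l.val + 1)

/-- `α_f(s)`: the number of those variables of `f`, its last variable `x_{j+1}` excepted, whose
subscript is larger than that of `x_{s+1}`. -/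
def alpha {m : ℕ} (f : Monomial m) (j s : Fin m) : ℕ := ((f.erase j).filter fun k => s < k).card

/-- `i_t` for `f = x_{i_1} ⋯ x_{i_t}`, `i_1 < ⋯ < i_t` (and `0` for `f = 1`). -/
def top {m : ℕ} (f : Monomial m) : ℕ := f.sup fun k => k.val + 1

theorem sup_erase_lt {m : ℕ} (f : Monomial m) (hf : f.Nonempty) :
    top (f.erase (f.max' hf)) < top f := by
  have h1 : (f.max' hf).val + 1 ≤ top f :=
    Finset.le_sup (f := fun k : Fin m => k.val + 1) (f.max'_mem hf)
  refine (Finset.sup_lt_iff (by simp; omega)).2 fun k hk => ?_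
  have h2 : k < f.max' hf :=
    lt_of_le_of_ne (f.le_max' k (Finset.mem_of_mem_erase hk)) (Finset.ne_of_mem_erase hk)
  have h3 : k.val < (f.max' hf).val := h2
  omega

theorem sup_insert_erase_lt {m : ℕ} (f : Monomial m) (hf : f.Nonempty) (s : Fin m)
    (hs : s < f.max' hf) : top (insert s (f.erase (f.max' hf))) < top f := by
  have h1 : (f.max' hf).val + 1 ≤ top f :=
    Finset.le_sup (f := fun k : Fin m => k.val + 1) (f.max'_mem hf)
  have h2 := sup_erase_lt f hf
  have h3 : s.val < (f.max' hf).val := hs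
  unfold top at h1 h2 ⊢
  rw [Finset.sup_insert]
  exact max_lt (by omega) h2

/-- The recursion for the number `N_f(w, a)` of words in `T(f)` having exactly `w` ones among their
first `a` entries. Here `f = x_{i_1} ⋯ x_{i_t}` with `i_1 < ⋯ < i_t = j + 1`. For `t ≤ 1` the number
is found by exhaustive search in `T(f)`, taken for the code spanned by all monomials of degree at
most `t`. -/
noncomputable def N {m : ℕ} (f : Monomial m) (w : ℤ) (a : ℕ) : ℤ :=
  if h : 2 ≤ f.card then
    have hf : f.Nonempty := Finset.card_pos.1 (by omega)
    if a ≤ 2 ^ (f.max' hf).val then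
      if w = 0 then
        (lam f : ℤ) - ∑ v ∈ range (2 ^ (m - f.card)), N f ((v : ℤ) + 1) a
      else
        (∑ s : {s : Fin m // s < f.max' hf ∧ s ∉ f},
          2 ^ alpha f (f.max' hf) s.val * N (insert s.val (f.erase (f.max' hf))) w a)
        + N (f.erase (f.max' hf)) w a
    else if a ≤ 2 ^ ((f.max' hf).val + 1) then
      N f (2 ^ ((f.max' hf).val + 1 - f.card) - w) (2 ^ ((f.max' hf).val + 1) - a)
    else
      N f (w - 2 ^ ((f.max' hf).val + 1 - f.card)) (a - 2 ^ ((f.max' hf).val + 1))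
  else
    ({p ∈ T (univ.filter fun g : Monomial m => g.card ≤ f.card) f |
      (prefixWeight a p : ℤ) = w}.ncard : ℤ)
termination_by (top f, a, if w = 0 then 1 else 0)
decreasing_by
  · have hv : (v : ℤ) + 1 ≠ 0 := by omega
    simp_all [Prod.lex_def]
  · exact Prod.Lex.left _ _ (sup_insert_erase_lt f hf s.val s.2.1)
  · exact Prod.Lex.left _ _ (sup_erase_lt f hf)
  · refine Prod.Lex.right _ (Prod.Lex.left _ _ ?_)
    have : 2 ^ ((f.max' hf).val + 1) = 2 * 2 ^ (f.max' hf).val := by ring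
    omega
  · refine Prod.Lex.right _ (Prod.Lex.left _ _ ?_)
    have : 0 < 2 ^ ((f.max' hf).val + 1) := by positivity
    omega

end QUPPolar

namespace QUPPolar

open Finset

/-! Order monomials by `binVal`, which is 2^m minus the index; the monomial of smallest index in a
codeword is then its leading monomial. The engine is to split off the last variable, p = a + x_n b.
On a block of length 2^(n+1) the values of p are those of a + b on the first half and those of a on
the second. The triangle inequality wt(b) ≤ wt(a) + wt(a + b) gives wt(p) ≥ wt(b), so by induction p
weighs at least as much as its leading monomial (`two_pow_le_pw_poly`).

Minimum words: if a word of the code has minimum punctured weight, replacing a + x_n b by x_n b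
cannot improve it, so the triangle inequality is tight and b is minimal for a code in fewer
variables. The induction must also cover words without x_n, whose two halves coincide but are
punctured differently; therefore it runs over all weights counting the positions before i with
multiplicity C and the others with C + 1 (`pw_eq_of_minimal`). For C = 0 it says that minimum words
of the punctured code come from words as heavy as their leading monomial, that is from some T(f).
Puncturing is injective because the generator matrix is triangular (`sw_poly_pos`,
`eq_of_puncture_eq`). Hence the punctured sets are disjoint, and sums of P_f count their union.

The sets T(f): if no later monomial has larger degree than f, tightness forces a to vanish wherever
b does, so a = b h with h affine (`exists_eq_mul_of_support`). Thus T(f) consists of the products of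
x_k + h_k over the variables of f, where h_k is affine in the smaller variables not dividing f
(`poly_mem_orbit`). Conversely, all monomials in such a product precede f, hence lie in a decreasing
set (`orbit_expansion`, `precedes_of_dominated`).

The recursion counts these products by prefix weight. Let x_j be the last variable of f. On the
first half of its block x_j = 1, so the factor x_j + h becomes an arbitrary affine form. Forms with
leading variable x_s give the orbit of f x_s / x_j with constant multiplicity (`sum_orbit_insert`),
the form 1 gives that of f / x_j, and the form 0 contributes to weight zero only. Reversal of
positions and periodicity settle the longer prefixes. -/

/-! ### Boolean polynomials as periodic functions on the natural numbers -/

/-- The variable `x_{k+1}` as a function on all positions. -/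
def var (k : ℕ) : ℕ → ZMod 2 := fun l => if l.testBit k then 0 else 1

/-- A squarefree monomial as a function on all positions. -/
def mon (g : Finset ℕ) : ℕ → ZMod 2 := ∏ k ∈ g, var k

/-- The polynomial with the set `S` of monomials. -/
def poly (S : Finset (Finset ℕ)) : ℕ → ZMod 2 := ∑ g ∈ S, mon g

/-- The exponent vector of a monomial, read as a binary number. -/
def binVal (g : Finset ℕ) : ℕ := ∑ k ∈ g, 2 ^ k

/-- The weight of the first `a` values. -/
def pw (a : ℕ) (q : ℕ → ZMod 2) : ℕ := ∑ l ∈ range a, (q l).val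

/-- `q` depends on the first `n` binary digits only. -/
def DependsBelow (n : ℕ) (q : ℕ → ZMod 2) : Prop :=
  ∀ l l' : ℕ, (∀ k < n, l.testBit k = l'.testBit k) → q l = q l'

/-- The monomials of `S` without the variable number `n`. -/
def lowPart (n : ℕ) (S : Finset (Finset ℕ)) : Finset (Finset ℕ) := S.filter fun g => n ∉ g

/-- The cofactor of the variable number `n` in `S`. -/
def highPart (n : ℕ) (S : Finset (Finset ℕ)) : Finset (Finset ℕ) :=
  (S.filter fun g => n ∈ g).image fun g => g.erase n

/-- The product of the variable number `n` and the polynomial `S`. -/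
def lift (n : ℕ) (S : Finset (Finset ℕ)) : Finset (Finset ℕ) := S.image fun g => insert n g

theorem zmod2_cases (z : ZMod 2) : z = 0 ∨ z = 1 := by revert z; decide

theorem fun_add_self (q : ℕ → ZMod 2) : q + q = 0 := by
  funext l; exact CharTwo.add_self_eq_zero _

/-! ### Prefix weights -/

theorem pw_congr {a : ℕ} {q q' : ℕ → ZMod 2} (h : ∀ l < a, q l = q' l) : pw a q = pw a q' :=
  sum_congr rfl fun l hl => by rw [h l (mem_range.1 hl)]

theorem pw_add_left (a b : ℕ) (q : ℕ → ZMod 2) :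
    pw (a + b) q = pw a q + pw b fun l => q (a + l) := sum_range_add _ _ _

@[simp] theorem pw_zero (a : ℕ) : pw a 0 = 0 := by simp [pw]

theorem pw_mono {a b : ℕ} (h : a ≤ b) (q : ℕ → ZMod 2) : pw a q ≤ pw b q :=
  sum_le_sum_of_subset (range_subset_range.2 h)

theorem pw_le_add (a : ℕ) (p q : ℕ → ZMod 2) : pw a q ≤ pw a p + pw a (p + q) := by
  unfold pw
  rw [← sum_add_distrib]
  refine sum_le_sum fun l _ => ?_
  have : ∀ x y : ZMod 2, y.val ≤ x.val + (x + y).val := by decide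
  exact this _ _

theorem pw_add_le (a : ℕ) (p q : ℕ → ZMod 2) : pw a (p + q) ≤ pw a p + pw a q := by
  have := pw_le_add a p (p + q)
  rwa [← add_assoc, fun_add_self, zero_add] at this

/-- Equality of the sums forces equality in the triangle inequality at each position; where q = 0 it
is strict unless p = 0. -/
theorem eq_zero_of_pw_add_eq {a : ℕ} {p q : ℕ → ZMod 2} (h : pw a p + pw a (p + q) = pw a q)
    {l : ℕ} (hl : l < a) (hq : q l = 0) : p l = 0 := by
  have key : ∀ x y : ZMod 2, y.val ≤ x.val + (x + y).val := by decide
  unfold pw at h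
  rw [← sum_add_distrib] at h
  have := (sum_eq_sum_iff_of_le fun l _ => key (p l) (q l)).1 h.symm l (mem_range.2 hl)
  rw [hq] at this
  revert this
  generalize p l = x
  revert x; decide

/-! ### Digits -/

theorem var_of_lt {n l : ℕ} (h : l < 2 ^ n) : var n l = 1 := by
  simp [var, Nat.testBit_lt_two_pow h]

theorem var_two_pow_add {n l : ℕ} (h : l < 2 ^ n) : var n (2 ^ n + l) = 0 := by
  simp [var, Nat.testBit_two_pow_add_eq, Nat.testBit_lt_two_pow h]

theorem DependsBelow.mono {n n' : ℕ} {q : ℕ → ZMod 2} (h : DependsBelow n q) (hn : n ≤ n') :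
    DependsBelow n' q := fun l l' hl => h l l' fun k hk => hl k (by omega)

theorem DependsBelow.two_pow_add {n : ℕ} {q : ℕ → ZMod 2} (h : DependsBelow n q) (l : ℕ) :
    q (2 ^ n + l) = q l := h _ _ fun _ hk => Nat.testBit_two_pow_add_gt hk l

theorem DependsBelow.mod {n : ℕ} {q : ℕ → ZMod 2} (h : DependsBelow n q) (l : ℕ) :
    q (l % 2 ^ n) = q l := h _ _ fun k hk => by simp [Nat.testBit_mod_two_pow, hk]

theorem DependsBelow.ext {n : ℕ} {p q : ℕ → ZMod 2} (hp : DependsBelow n p)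
    (hq : DependsBelow n q) (h : ∀ l < 2 ^ n, p l = q l) : p = q := by
  funext l
  rw [← hp.mod, ← hq.mod, h _ (Nat.mod_lt _ (by positivity))]

theorem DependsBelow.add {n : ℕ} {p q : ℕ → ZMod 2} (hp : DependsBelow n p)
    (hq : DependsBelow n q) : DependsBelow n (p + q) := fun l l' h => by
  simp only [Pi.add_apply]; rw [hp l l' h, hq l l' h]

theorem DependsBelow.mul {n : ℕ} {p q : ℕ → ZMod 2} (hp : DependsBelow n p)
    (hq : DependsBelow n q) : DependsBelow n (p * q) := fun l l' h => by
  simp only [Pi.mul_apply]; rw [hp l l' h, hq l l' h]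

theorem dependsBelow_var {n k : ℕ} (h : k < n) : DependsBelow n (var k) := fun l l' hl => by
  simp [var, hl k h]

theorem dependsBelow_one (n : ℕ) : DependsBelow n 1 := fun _ _ _ => rfl

theorem dependsBelow_zero (n : ℕ) : DependsBelow n 0 := fun _ _ _ => rfl

theorem dependsBelow_mon {n : ℕ} {g : Finset ℕ} (h : g ⊆ range n) : DependsBelow n (mon g) :=
  fun l l' hl => by
    simp only [mon, Finset.prod_apply]
    exact prod_congr rfl fun k hk => dependsBelow_var (mem_range.1 (h hk)) l l' hl

theorem dependsBelow_poly {n : ℕ} {S : Finset (Finset ℕ)} (h : ∀ g ∈ S, g ⊆ range n) :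
    DependsBelow n (poly S) :=
  fun l l' hl => by
    simp only [poly, Finset.sum_apply]
    exact sum_congr rfl fun g hg => dependsBelow_mon (h g hg) l l' hl

/-- The variable number n is 1 on the first half of the block and 0 on the second, where a repeats
its values. -/
theorem pw_two_pow_succ {n : ℕ} {a b : ℕ → ZMod 2} (ha : DependsBelow n a) :
    pw (2 ^ (n + 1)) (a + var n * b) = pw (2 ^ n) (a + b) + pw (2 ^ n) a := by
  rw [pow_succ, mul_two, pw_add_left]
  congr 1
  · exact pw_congr fun l hl => by simp [var_of_lt hl]
  · exact pw_congr fun l hl => by simp [var_two_pow_add hl, ha.two_pow_add]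

/-! ### Splitting off the last variable -/

theorem poly_split (n : ℕ) (S : Finset (Finset ℕ)) :
    poly S = poly (lowPart n S) + var n * poly (highPart n S) := by
  unfold poly lowPart highPart
  rw [sum_image, mul_sum, ← sum_filter_add_sum_filter_not S (fun g => n ∉ g) mon]
  · congr 1
    simp only [not_not]
    refine sum_congr rfl fun g hg => ?_
    exact (mul_prod_erase g var (mem_filter.1 hg).2).symm
  · intro g hg g' hg' h
    simp only [coe_filter, Set.mem_ofPred_eq] at hg hg'
    rw [← insert_erase hg.2, ← insert_erase hg'.2]
    exact congrArg (insert n) h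

theorem mem_highPart {n : ℕ} {S : Finset (Finset ℕ)} {g : Finset ℕ} :
    g ∈ highPart n S ↔ n ∉ g ∧ insert n g ∈ S := by
  simp only [highPart, mem_image, mem_filter]
  constructor
  · rintro ⟨g', ⟨h1, h2⟩, rfl⟩
    simp [insert_erase h2, h1]
  · rintro ⟨h1, h2⟩
    exact ⟨_, ⟨h2, by simp⟩, erase_insert h1⟩

theorem mem_lowPart {n : ℕ} {S : Finset (Finset ℕ)} {g : Finset ℕ} :
    g ∈ lowPart n S ↔ g ∈ S ∧ n ∉ g := mem_filter

theorem subset_range_of_succ {n : ℕ} {g : Finset ℕ} (h : g ⊆ range (n + 1)) (hn : n ∉ g) :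
    g ⊆ range n := fun k hk => by
  have := mem_range.1 (h hk)
  have : k ≠ n := fun e => hn (e ▸ hk)
  exact mem_range.2 (by omega)

theorem notMem_of_subset_range {n : ℕ} {g : Finset ℕ} (h : g ⊆ range n) : n ∉ g := fun hn => by
  simpa using h hn

theorem lowPart_subset_range {n : ℕ} {S : Finset (Finset ℕ)} (hS : ∀ g ∈ S, g ⊆ range (n + 1)) :
    ∀ g ∈ lowPart n S, g ⊆ range n := fun g hg =>
  subset_range_of_succ (hS g (mem_lowPart.1 hg).1) (mem_lowPart.1 hg).2

theorem highPart_subset_range {n : ℕ} {S : Finset (Finset ℕ)} (hS : ∀ g ∈ S, g ⊆ range (n + 1)) :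
    ∀ g ∈ highPart n S, g ⊆ range n := fun g hg =>
  subset_range_of_succ ((subset_insert n g).trans (hS _ (mem_highPart.1 hg).2)) (mem_highPart.1 hg).1

theorem poly_lift {n : ℕ} {S : Finset (Finset ℕ)} (h : ∀ g ∈ S, n ∉ g) :
    poly (lift n S) = var n * poly S := by
  unfold poly lift
  rw [sum_image, mul_sum]
  · exact sum_congr rfl fun g hg => prod_insert (h g hg)
  · intro g hg g' hg' e
    rw [← erase_insert (h g hg), ← erase_insert (h g' hg')]
    exact congrArg (fun s => s.erase n) e

theorem poly_union {S S' : Finset (Finset ℕ)} (h : Disjoint S S') :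
    poly (S ∪ S') = poly S + poly S' := sum_union h

theorem binVal_lt {n : ℕ} {g : Finset ℕ} (h : g ⊆ range n) : binVal g < 2 ^ n :=
  Nat.geomSum_lt le_rfl fun _ hk => mem_range.1 (h hk)

theorem binVal_insert {n : ℕ} {g : Finset ℕ} (h : n ∉ g) :
    binVal (insert n g) = 2 ^ n + binVal g := sum_insert h

theorem binVal_injective : Function.Injective binVal := geomSum_injective le_rfl

theorem two_pow_le_binVal {n : ℕ} {g : Finset ℕ} (h : n ∈ g) : 2 ^ n ≤ binVal g :=
  single_le_sum (f := fun k => 2 ^ k) (fun _ _ => Nat.zero_le _) h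

theorem exists_binVal_max {S : Finset (Finset ℕ)} (h : S.Nonempty) :
    ∃ f ∈ S, ∀ g ∈ S, binVal g ≤ binVal f := S.exists_max_image binVal h

/-- The last variable divides the leading monomial iff the cofactor is nonzero, whose leading
monomial it then determines. -/
theorem leading_highPart {n : ℕ} {S : Finset (Finset ℕ)} {f : Finset ℕ} (hf : f ∈ S)
    (hn : n ∈ f) (hmax : ∀ g ∈ S, binVal g ≤ binVal f) :
    f.erase n ∈ highPart n S ∧ ∀ g ∈ highPart n S, binVal g ≤ binVal (f.erase n) := by
  refine ⟨mem_highPart.2 ⟨by simp, by rwa [insert_erase hn]⟩, fun g hg => ?_⟩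
  have h1 := hmax _ (mem_highPart.1 hg).2
  rw [binVal_insert (mem_highPart.1 hg).1, ← insert_erase hn, binVal_insert (by simp)] at h1
  simpa using h1

theorem notMem_of_leading {n : ℕ} {S : Finset (Finset ℕ)} (hS : ∀ g ∈ S, g ⊆ range (n + 1))
    {f : Finset ℕ} (hf : f ∈ S) (hn : n ∉ f) (hmax : ∀ g ∈ S, binVal g ≤ binVal f) :
    ∀ g ∈ S, g ⊆ range n := fun g hg => by
  refine subset_range_of_succ (hS g hg) fun h => ?_
  have h1 := binVal_lt (subset_range_of_succ (hS f hf) hn)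
  have h2 := hmax g hg
  have h3 := two_pow_le_binVal h
  omega

theorem card_add_le_of_subset {n : ℕ} {f : Finset ℕ} (hf : f ⊆ range n) : f.card ≤ n := by
  simpa using card_le_card hf

theorem pw_two_pow_succ_of_dependsBelow {n : ℕ} {q : ℕ → ZMod 2} (h : DependsBelow n q) :
    pw (2 ^ (n + 1)) q = 2 * pw (2 ^ n) q := by
  have := pw_two_pow_succ (b := 0) h
  simp only [mul_zero, add_zero] at this
  omega

theorem eq_singleton_empty {S : Finset (Finset ℕ)} (hS : ∀ g ∈ S, g ⊆ range 0)
    {f : Finset ℕ} (hf : f ∈ S) : S = {∅} ∧ f = ∅ := by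
  have h : f = ∅ := by simpa using hS f hf
  refine ⟨(eq_singleton_iff_nonempty_unique_mem).2 ⟨⟨f, hf⟩, fun g hg => ?_⟩, h⟩
  simpa using hS g hg

theorem poly_singleton_empty : poly {∅} = 1 := by simp [poly, mon]

@[simp] theorem poly_empty : poly ∅ = 0 := by simp [poly]

theorem pw_one_one : pw 1 1 = 1 := by simp [pw]; decide

/-! ### The weight bound by the leading monomial -/

/-- A polynomial weighs at least as much as its leading monomial. -/
theorem two_pow_le_pw_poly {n : ℕ} {S : Finset (Finset ℕ)} (hS : ∀ g ∈ S, g ⊆ range n)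
    {f : Finset ℕ} (hf : f ∈ S) (hmax : ∀ g ∈ S, binVal g ≤ binVal f) :
    2 ^ (n - f.card) ≤ pw (2 ^ n) (poly S) := by
  induction n generalizing S f with
  | zero =>
    obtain ⟨rfl, rfl⟩ := eq_singleton_empty hS hf
    simp [poly_singleton_empty, pw_one_one]
  | succ n ih =>
    by_cases hn : n ∈ f
    · rw [poly_split n S, pw_two_pow_succ (dependsBelow_poly (lowPart_subset_range hS))]
      obtain ⟨h1, h2⟩ := leading_highPart hf hn hmax
      have h3 := ih (highPart_subset_range hS) h1 h2
      have h4 := pw_le_add (2 ^ n) (poly (lowPart n S)) (poly (highPart n S))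
      rw [card_erase_of_mem hn] at h3
      have h5 : n + 1 - f.card = n - (f.card - 1) := by
        have := card_pos.2 ⟨n, hn⟩
        omega
      rw [h5]
      omega
    · have h1 := notMem_of_leading hS hf hn hmax
      have h4 := ih h1 hf hmax
      have h5 : n + 1 - f.card = (n - f.card) + 1 := by
        have := card_add_le_of_subset (h1 f hf)
        omega
      rw [pw_two_pow_succ_of_dependsBelow (dependsBelow_poly h1), h5, pow_succ]
      omega

/-! ### Words of minimum punctured weight -/

/-- The weight of the values from position `i` (inclusive) to `2 ^ n` (exclusive). -/
def sw (n i : ℕ) (q : ℕ → ZMod 2) : ℕ := ∑ l ∈ Ico i (2 ^ n), (q l).val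

theorem pw_add_sw {n i : ℕ} (h : i ≤ 2 ^ n) (q : ℕ → ZMod 2) :
    pw i q + sw n i q = pw (2 ^ n) q := sum_range_add_sum_Ico _ h

theorem sw_le_add (n i : ℕ) (p q : ℕ → ZMod 2) : sw n i q ≤ sw n i p + sw n i (p + q) := by
  unfold sw
  rw [← sum_add_distrib]
  refine sum_le_sum fun l _ => ?_
  have : ∀ x y : ZMod 2, y.val ≤ x.val + (x + y).val := by decide
  exact this _ _

@[simp] theorem sw_zero (n i : ℕ) : sw n i 0 = 0 := by simp [sw]

theorem sw_succ_of_le {n i : ℕ} (hi : i ≤ 2 ^ n) {a b : ℕ → ZMod 2} (ha : DependsBelow n a) :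
    sw (n + 1) i (a + var n * b) = sw n i (a + b) + pw (2 ^ n) a := by
  unfold sw pw
  have h : 2 ^ n ≤ 2 ^ (n + 1) := Nat.pow_le_pow_right (by norm_num) (by omega)
  rw [← sum_Ico_consecutive _ hi h]
  congr 1
  · exact sum_congr rfl fun l hl => by simp [var_of_lt (mem_Ico.1 hl).2]
  · rw [sum_Ico_eq_sum_range]
    have e : 2 ^ (n + 1) - 2 ^ n = 2 ^ n := by rw [pow_succ]; omega
    rw [e]
    exact sum_congr rfl fun l hl => by
      simp [var_two_pow_add (mem_range.1 hl), ha.two_pow_add]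

theorem sw_succ_two_pow_add {n i : ℕ} {a b : ℕ → ZMod 2} (ha : DependsBelow n a) :
    sw (n + 1) (2 ^ n + i) (a + var n * b) = sw n i a := by
  unfold sw
  rw [pow_succ, mul_two, add_comm _ i, ← sum_Ico_add]
  exact sum_congr rfl fun l hl => by
    simp [var_two_pow_add (mem_Ico.1 hl).2, ha.two_pow_add]

/-- If a nonzero polynomial of a monomial code minimizes a weight which counts the positions before
`i` with multiplicity `C` and the other ones with multiplicity `C + 1`, it weighs as much as its
leading monomial. -/
theorem pw_eq_of_minimal {n C i : ℕ} {I S : Finset (Finset ℕ)} (hI : ∀ g ∈ I, g ⊆ range n)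
    (hS : S ⊆ I) (hC : 1 ≤ C ∨ ∀ g ∈ I, i + binVal g < 2 ^ n)
    (hmin : ∀ S' ⊆ I, S'.Nonempty →
      C * pw (2 ^ n) (poly S) + sw n i (poly S) ≤ C * pw (2 ^ n) (poly S') + sw n i (poly S'))
    {f : Finset ℕ} (hf : f ∈ S) (hmax : ∀ g ∈ S, binVal g ≤ binVal f) :
    pw (2 ^ n) (poly S) = 2 ^ (n - f.card) := by
  induction n generalizing C i I S f with
  | zero =>
    obtain ⟨rfl, rfl⟩ := eq_singleton_empty (fun g hg => hI g (hS hg)) hf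
    simp [poly_singleton_empty, pw_one_one]
  | succ n ih =>
    have hSr : ∀ g ∈ S, g ⊆ range (n + 1) := fun g hg => hI g (hS hg)
    by_cases hn : n ∈ f
    · obtain ⟨h1, h2⟩ := leading_highPart hf hn hmax
      have hsub : highPart n S ⊆ highPart n I := fun g hg =>
        mem_highPart.2 ⟨(mem_highPart.1 hg).1, hS (mem_highPart.1 hg).2⟩
      have hcard : n + 1 - f.card = n - (f.erase n).card := by
        have := card_pos.2 ⟨n, hn⟩
        rw [card_erase_of_mem hn]
        omega
      have ha := dependsBelow_poly (lowPart_subset_range hSr)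
      -- The competitors are the multiples of the last variable: they stay in the code and live on
      -- the first half only, where they equal their cofactor.
      have hlift : ∀ S' ⊆ highPart n I, S'.Nonempty → lift n S' ⊆ I ∧ (lift n S').Nonempty ∧
          poly (lift n S') = 0 + var n * poly S' := fun S' hS' hne => by
        refine ⟨?_, hne.image _, ?_⟩
        · intro g hg
          obtain ⟨g', hg', rfl⟩ := mem_image.1 hg
          exact (mem_highPart.1 (hS' hg')).2
        · rw [zero_add, poly_lift fun g hg => (mem_highPart.1 (hS' hg)).1]
      have h3 := pw_le_add (2 ^ n) (poly (lowPart n S)) (poly (highPart n S))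
      have hw : pw (2 ^ (n + 1)) (poly S) = pw (2 ^ n) (poly (lowPart n S) + poly (highPart n S))
          + pw (2 ^ n) (poly (lowPart n S)) := by
        conv_lhs => rw [poly_split n S, pw_two_pow_succ ha]
      rw [hcard]
      rcases le_or_gt i (2 ^ n) with hi | hi
      · have hs : sw (n + 1) i (poly S) = sw n i (poly (lowPart n S) + poly (highPart n S))
            + pw (2 ^ n) (poly (lowPart n S)) := by
          conv_lhs => rw [poly_split n S, sw_succ_of_le hi ha]
        have hle : ∀ S' ⊆ highPart n I, S'.Nonempty →
            C * pw (2 ^ (n + 1)) (poly S) + sw (n + 1) i (poly S) ≤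
              C * pw (2 ^ n) (poly S') + sw n i (poly S') := fun S' hS' hne => by
          obtain ⟨l1, l2, l3⟩ := hlift S' hS' hne
          have := hmin _ l1 l2
          rwa [l3, pw_two_pow_succ (dependsBelow_zero n), sw_succ_of_le hi (dependsBelow_zero n),
            zero_add, pw_zero, add_zero, add_zero] at this
        have h4 := hle _ hsub ⟨_, h1⟩
        have h5 := sw_le_add n i (poly (lowPart n S)) (poly (highPart n S))
        have p1 := pw_add_sw hi (poly (lowPart n S))
        have p2 := pw_add_sw hi (poly (highPart n S))
        have p3 := pw_add_sw hi (poly (lowPart n S) + poly (highPart n S))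
        have p4 := pw_le_add i (poly (lowPart n S)) (poly (highPart n S))
        have p5 := pw_add_le i (poly (lowPart n S)) (poly (highPart n S))
        have h6 : C * pw (2 ^ n) (poly (highPart n S)) ≤ C * pw (2 ^ (n + 1)) (poly S) :=
          Nat.mul_le_mul_left _ (by omega)
        -- With low part a and cofactor b, the case C = 0 needs care, since positions before i are
        -- not counted. Minimality and the triangle inequality after i give pw (2^n) a ≤ sw n i a,
        -- so a vanishes before i and a + b agrees with b there. For C ≥ 1 both summands are bounded
        -- below by those of b, so both bounds are tight.
        have heq : pw (2 ^ (n + 1)) (poly S) = pw (2 ^ n) (poly (highPart n S)) := by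
          rcases Nat.eq_zero_or_pos C with rfl | hC0
          · omega
          · have h7 : C * pw (2 ^ (n + 1)) (poly S) = C * pw (2 ^ n) (poly (highPart n S)) := by
              omega
            exact Nat.eq_of_mul_eq_mul_left hC0 h7
        rw [heq]
        refine ih (C := C) (i := i) (highPart_subset_range hI) hsub (hC.imp id fun h g hg => ?_)
          (fun S' hS' hne => ?_) h1 h2
        · have := h _ (mem_highPart.1 hg).2
          rw [binVal_insert (mem_highPart.1 hg).1, pow_succ] at this
          omega
        · have := hle S' hS' hne
          omega
      · obtain ⟨j, rfl⟩ := Nat.exists_eq_add_of_lt hi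
        rw [add_assoc] at hmin hC
        -- C = 0 is impossible here: f contains n, so its binary value is at least 2^n, while i
        -- exceeds 2^n.
        have hC1 : 1 ≤ C := by
          rcases hC with h | h
          · exact h
          · have := h f (hS hf)
            have := two_pow_le_binVal hn
            rw [pow_succ] at *
            omega
        have hle : ∀ S' ⊆ highPart n I, S'.Nonempty →
            C * pw (2 ^ (n + 1)) (poly S) ≤ C * pw (2 ^ n) (poly S') := fun S' hS' hne => by
          obtain ⟨l1, l2, l3⟩ := hlift S' hS' hne
          have := hmin _ l1 l2
          rw [l3, pw_two_pow_succ (dependsBelow_zero n),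
            sw_succ_two_pow_add (dependsBelow_zero n), sw_zero, pw_zero] at this
          simp only [zero_add, add_zero] at this
          omega
        have hle' : ∀ S' ⊆ highPart n I, S'.Nonempty →
            pw (2 ^ (n + 1)) (poly S) ≤ pw (2 ^ n) (poly S') := fun S' hS' hne =>
          Nat.le_of_mul_le_mul_left (hle S' hS' hne) hC1
        have heq : pw (2 ^ (n + 1)) (poly S) = pw (2 ^ n) (poly (highPart n S)) :=
          le_antisymm (hle' _ hsub ⟨_, h1⟩) (by omega)
        rw [heq]
        -- The whole first half has the same multiplicity C, so the cofactor minimizes the plain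
        -- weight; the choice i = 2^n makes the suffix term empty.
        refine ih (C := 1) (i := 2 ^ n) (highPart_subset_range hI) hsub (Or.inl le_rfl)
          (fun S' hS' hne => ?_) h1 h2
        simp only [sw, Ico_self, sum_empty]
        have := hle' S' hS' hne
        omega
    · have h1 := notMem_of_leading hSr hf hn hmax
      have hsub : S ⊆ lowPart n I := fun g hg =>
        mem_lowPart.2 ⟨hS hg, notMem_of_subset_range (h1 g hg)⟩
      have hcard : n + 1 - f.card = (n - f.card) + 1 := by
        have := card_add_le_of_subset (h1 f hf)
        omega
      have hd : ∀ S' ⊆ lowPart n I, DependsBelow n (poly S') := fun S' hS' =>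
        dependsBelow_poly fun g hg => lowPart_subset_range hI g (hS' hg)
      have hI' : ∀ S' ⊆ lowPart n I, S' ⊆ I := fun S' hS' => hS'.trans (filter_subset _ _)
      rw [pw_two_pow_succ_of_dependsBelow (hd S hsub), hcard, pow_succ, mul_comm]
      congr 1
      rcases le_or_gt i (2 ^ n) with hi | hi
      -- The equal halves are superposed: the second one counts C + 1 everywhere, the first C before
      -- i and C + 1 after, in total 2C + 1 and 2C + 2.
      · refine ih (C := 2 * C + 1) (i := i) (lowPart_subset_range hI) hsub (Or.inl (by omega))
          (fun S' hS' hne => ?_) hf hmax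
        have := hmin S' (hI' _ hS') hne
        have e : ∀ S' ⊆ lowPart n I, sw (n + 1) i (poly S') =
            sw n i (poly S') + pw (2 ^ n) (poly S') := fun S' hS' => by
          have := sw_succ_of_le (b := 0) hi (hd S' hS')
          simpa using this
        rw [pw_two_pow_succ_of_dependsBelow (hd S hsub),
          pw_two_pow_succ_of_dependsBelow (hd S' hS'), e S hsub, e S' hS'] at this
        linarith
      · obtain ⟨j, rfl⟩ := Nat.exists_eq_add_of_lt hi
        rw [add_assoc] at hmin hC
        -- Now the first half counts C everywhere and the second changes multiplicity at j + 1: in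
        -- total 2C before it and 2C + 1 after.
        refine ih (C := 2 * C) (i := j + 1) (lowPart_subset_range hI) hsub
          (hC.imp (fun h => by omega) fun h g hg => ?_) (fun S' hS' hne => ?_) hf hmax
        · have := h g (hI' _ subset_rfl hg)
          rw [pow_succ] at this
          omega
        · have := hmin S' (hI' _ hS') hne
          have e : ∀ S' ⊆ lowPart n I, sw (n + 1) (2 ^ n + (j + 1)) (poly S') =
              sw n (j + 1) (poly S') := fun S' hS' => by
            have := sw_succ_two_pow_add (i := j + 1) (b := 0) (hd S' hS')
            simpa using this
          rw [pw_two_pow_succ_of_dependsBelow (hd S hsub),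
            pw_two_pow_succ_of_dependsBelow (hd S' hS'), e S hsub, e S' hS'] at this
          linarith

/-! ### Triangularity of the generator matrix -/

/-- The digits of this position are the complement of f, so its evaluation point is the indicator
vector of f. -/
theorem mon_complement {n : ℕ} {f : Finset ℕ} (hf : f ⊆ range n) {g : Finset ℕ}
    (hg : g ⊆ range n) : mon g (2 ^ n - (binVal f + 1)) = if g ⊆ f then 1 else 0 := by
  have h : ∀ k < n, var k (2 ^ n - (binVal f + 1)) = if k ∈ f then 1 else 0 := fun k hk => by
    have hb : (binVal f).testBit k = true ↔ k ∈ f := by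
      rw [← Nat.mem_bitIndices, ← List.mem_toFinset]
      unfold binVal
      rw [Finset.toFinset_bitIndices_sum_two_pow]
    simp only [var, Nat.testBit_two_pow_sub_succ (binVal_lt hf), hk, decide_true, Bool.true_and,
      Bool.not_eq_true']
    by_cases h1 : k ∈ f
    · simp [h1, hb.2 h1]
    · have : (binVal f).testBit k = false := by simpa using fun h => h1 (hb.1 h)
      simp [h1, this]
  unfold mon
  rw [Finset.prod_apply, prod_congr rfl fun k hk => h k (mem_range.1 (hg hk))]
  split_ifs with hs
  · exact prod_eq_one fun k hk => if_pos (hs hk)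
  · obtain ⟨k, hk, hk'⟩ := not_subset.1 hs
    exact prod_eq_zero hk (if_neg hk')

/-- The generator matrix is triangular. -/
theorem sw_poly_pos {n i : ℕ} {S : Finset (Finset ℕ)} (hS : ∀ g ∈ S, g ⊆ range n)
    (hne : S.Nonempty) (hi : ∀ g ∈ S, i + binVal g < 2 ^ n) : 0 < sw n i (poly S) := by
  -- A divisor of f has at most its binary value, so minimality leaves f as the only monomial of S
  -- not vanishing at the indicator of f; that position lies outside the first i.
  obtain ⟨f, hf, hmin⟩ := S.exists_min_image binVal hne
  have h1 : poly S (2 ^ n - (binVal f + 1)) = 1 := by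
    simp only [poly, Finset.sum_apply]
    rw [sum_eq_single_of_mem f hf fun g hg hgf => ?_, mon_complement (hS f hf) (hS f hf),
      if_pos subset_rfl]
    rw [mon_complement (hS f hf) (hS g hg), if_neg fun hs => hgf ?_]
    exact binVal_injective (le_antisymm (sum_le_sum_of_subset hs) (hmin g hg))
  have h2 : 2 ^ n - (binVal f + 1) ∈ Ico i (2 ^ n) := by
    have := hi f hf
    rw [mem_Ico]
    omega
  refine lt_of_lt_of_le ?_
    (single_le_sum (f := fun l => (poly S l).val) (fun _ _ => Nat.zero_le _) h2)
  rw [h1]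
  decide

/-! ### Dependence on sets of digits, and addition of polynomials -/

/-- `q` depends on the binary digits in `V` only. -/
def DependsOn (V : Finset ℕ) (q : ℕ → ZMod 2) : Prop :=
  ∀ l l' : ℕ, (∀ k ∈ V, l.testBit k = l'.testBit k) → q l = q l'

theorem dependsBelow_iff {n : ℕ} {q : ℕ → ZMod 2} : DependsBelow n q ↔ DependsOn (range n) q := by
  simp [DependsBelow, DependsOn]

theorem DependsOn.mono {V V' : Finset ℕ} {q : ℕ → ZMod 2} (h : DependsOn V q) (hV : V ⊆ V') :
    DependsOn V' q := fun l l' hl => h l l' fun k hk => hl k (hV hk)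

theorem dependsOn_poly {V : Finset ℕ} {S : Finset (Finset ℕ)} (h : ∀ g ∈ S, g ⊆ V) :
    DependsOn V (poly S) := fun l l' hl => by
  simp only [poly, mon, Finset.sum_apply, Finset.prod_apply]
  refine sum_congr rfl fun g hg => prod_congr rfl fun k hk => ?_
  simp [var, hl k (h g hg hk)]

/-- The position which differs from `l` at most in its digit `n`, where `var n` takes the
value `z`. -/
theorem exists_var_eq (n l : ℕ) (z : ZMod 2) :
    ∃ l' : ℕ, var n l' = z ∧ ∀ k ≠ n, l'.testBit k = l.testBit k := by
  by_cases h : var n l = z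
  · exact ⟨l, h, fun _ _ => rfl⟩
  · refine ⟨l ^^^ 2 ^ n, ?_, fun k hk => ?_⟩
    · have h2 : var n (l ^^^ 2 ^ n) = var n l + 1 := by
        simp only [var, Nat.testBit_xor, Nat.testBit_two_pow_self]
        cases l.testBit n
        · simp; decide
        · simp
      rw [h2]
      revert h
      generalize var n l = y
      revert y z; decide
    · simp [Nat.testBit_xor, hk.symm]

theorem poly_symmDiff (S S' : Finset (Finset ℕ)) : poly (symmDiff S S') = poly S + poly S' := by
  have h1 : poly S = poly (S \ S') + poly (S ∩ S') := by
    rw [← poly_union (disjoint_sdiff_inter S S'), sdiff_union_inter]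
  have h2 : poly S' = poly (S' \ S) + poly (S ∩ S') := by
    rw [inter_comm, ← poly_union (disjoint_sdiff_inter S' S), sdiff_union_inter]
  have h3 : Disjoint (S \ S') (S' \ S) := disjoint_sdiff_sdiff
  have h4 := fun_add_self (poly (S ∩ S'))
  rw [symmDiff_def, sup_eq_union, poly_union h3, h1, h2]
  linear_combination (norm := ring_nf) -h4

/-! ### Polynomials of bounded degree -/

/-- The polynomials of degree less than `d` in the variables from `V`. -/
noncomputable def polys (V : Finset ℕ) (d : ℕ) : Finset (ℕ → ZMod 2) := by
  classical exact ((V.powerset.filter fun g => g.card < d).powerset).image poly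

theorem mem_polys {V : Finset ℕ} {d : ℕ} {q : ℕ → ZMod 2} :
    q ∈ polys V d ↔ ∃ S : Finset (Finset ℕ), (∀ g ∈ S, g ⊆ V ∧ g.card < d) ∧ poly S = q := by
  classical
  simp [polys, subset_iff (s₁ := (_ : Finset (Finset ℕ)))]

theorem polys_mono {V V' : Finset ℕ} (h : V ⊆ V') (d : ℕ) : polys V d ⊆ polys V' d := fun q hq => by
  obtain ⟨S, hS, rfl⟩ := mem_polys.1 hq
  exact mem_polys.2 ⟨S, fun g hg => ⟨(hS g hg).1.trans h, (hS g hg).2⟩, rfl⟩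

theorem add_mem_polys {V : Finset ℕ} {d : ℕ} {p q : ℕ → ZMod 2} (hp : p ∈ polys V d)
    (hq : q ∈ polys V d) : p + q ∈ polys V d := by
  obtain ⟨S, hS, rfl⟩ := mem_polys.1 hp
  obtain ⟨S', hS', rfl⟩ := mem_polys.1 hq
  refine mem_polys.2 ⟨symmDiff S S', fun g hg => ?_, poly_symmDiff S S'⟩
  rcases mem_symmDiff.1 hg with h | h
  · exact hS g h.1
  · exact hS' g h.1

theorem zero_mem_polys (V : Finset ℕ) (d : ℕ) : (0 : ℕ → ZMod 2) ∈ polys V d :=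
  mem_polys.2 ⟨∅, by simp, by simp⟩

theorem one_mem_polys (V : Finset ℕ) : (1 : ℕ → ZMod 2) ∈ polys V 2 :=
  mem_polys.2 ⟨{∅}, by simp, poly_singleton_empty⟩

theorem var_mem_polys {V : Finset ℕ} {k : ℕ} (hk : k ∈ V) : var k ∈ polys V 2 :=
  mem_polys.2 ⟨{{k}}, by simpa using hk, by simp [poly, mon]⟩

theorem polys_dependsOn {V : Finset ℕ} {d : ℕ} {q : ℕ → ZMod 2} (h : q ∈ polys V d) :
    DependsOn V q := by
  obtain ⟨S, hS, rfl⟩ := mem_polys.1 h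
  exact dependsOn_poly fun g hg => (hS g hg).1

theorem polys_insert_cases {V : Finset ℕ} {s : ℕ} {q : ℕ → ZMod 2}
    (h : q ∈ polys (insert s V) 2) : q ∈ polys V 2 ∨ ∃ h ∈ polys V 2, q = var s + h := by
  obtain ⟨S, hS, rfl⟩ := mem_polys.1 h
  have h1 : poly (lowPart s S) ∈ polys V 2 := mem_polys.2 ⟨_, fun g hg => by
    obtain ⟨h1, h2⟩ := mem_lowPart.1 hg
    exact ⟨(subset_insert_iff_of_notMem h2).1 (hS g h1).1, (hS g h1).2⟩, rfl⟩
  have h2 : highPart s S ⊆ {∅} := fun g hg => by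
    obtain ⟨h2, h3⟩ := mem_highPart.1 hg
    have := (hS _ h3).2
    rw [card_insert_of_notMem h2] at this
    rw [mem_singleton, ← card_eq_zero]
    omega
  rw [poly_split s S]
  rcases subset_singleton_iff.1 h2 with h3 | h3
  · left; simpa [h3] using h1
  · right
    exact ⟨_, h1, by rw [h3, poly_singleton_empty, mul_one, add_comm]⟩

theorem var_notMem_polys {V : Finset ℕ} {s d : ℕ} (hs : s ∉ V) : var s ∉ polys V d := fun h => by
  obtain ⟨l, hl, hl'⟩ := exists_var_eq s 0 0
  obtain ⟨l1, hl1, hl1'⟩ := exists_var_eq s 0 1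
  have := polys_dependsOn h l l1 fun k hk => by
    have : k ≠ s := fun e => hs (e ▸ hk)
    rw [hl' k this, hl1' k this]
  rw [hl, hl1] at this
  exact absurd this (by decide)

theorem sum_polys_add {V : Finset ℕ} {h : ℕ → ZMod 2} (hh : h ∈ polys V 2)
    (F : (ℕ → ZMod 2) → ℕ) : ∑ q ∈ polys V 2, F (q + h) = ∑ q ∈ polys V 2, F q := by
  have e : ∀ q : ℕ → ZMod 2, q + h + h = q := fun q => by rw [add_assoc, fun_add_self, add_zero]
  exact sum_bij' (fun q _ => q + h) (fun q _ => q + h) (fun q hq => add_mem_polys hq hh)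
    (fun q hq => add_mem_polys hq hh) (fun q _ => e q) (fun q _ => e q) (fun q _ => rfl)

theorem sum_polys_insert {V : Finset ℕ} {s : ℕ} (hs : s ∉ V) (F : (ℕ → ZMod 2) → ℕ) :
    ∑ q ∈ polys (insert s V) 2, F q = ∑ q ∈ polys V 2, F q + ∑ q ∈ polys V 2, F (var s + q) := by
  classical
  have h1 : polys (insert s V) 2 = polys V 2 ∪ (polys V 2).image (fun q => var s + q) := by
    ext q
    rw [mem_union, mem_image]
    constructor
    · intro h
      rcases polys_insert_cases h with h | ⟨h, h1, h2⟩
      · exact Or.inl h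
      · exact Or.inr ⟨h, h1, h2.symm⟩
    · rintro (h | ⟨h, h1, rfl⟩)
      · exact polys_mono (subset_insert s V) 2 h
      · exact add_mem_polys (var_mem_polys (mem_insert_self s V))
          (polys_mono (subset_insert s V) 2 h1)
  have h2 : Disjoint (polys V 2) ((polys V 2).image fun q => var s + q) := by
    rw [Finset.disjoint_left]
    intro q hq hq'
    obtain ⟨h, h1, rfl⟩ := mem_image.1 hq'
    have := add_mem_polys hq h1
    rw [add_assoc, fun_add_self, add_zero] at this
    exact var_notMem_polys hs this
  rw [h1, sum_union h2, sum_image fun q _ q' _ h => add_left_cancel h]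

open Classical in
theorem polys_empty_eq : polys ∅ 2 = {0, 1} := by
  ext q
  rw [mem_polys, mem_insert, mem_singleton]
  constructor
  · rintro ⟨S, hS, rfl⟩
    have : S ⊆ {∅} := fun g hg => by simpa using (hS g hg).1
    rcases subset_singleton_iff.1 this with rfl | rfl
    · left; simp
    · right; exact poly_singleton_empty
  · rintro (rfl | rfl)
    · exact mem_polys.1 (zero_mem_polys _ _)
    · exact mem_polys.1 (one_mem_polys _)

theorem sum_polys_empty (F : (ℕ → ZMod 2) → ℕ) : ∑ q ∈ polys ∅ 2, F q = F 0 + F 1 := by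
  classical rw [polys_empty_eq, sum_pair zero_ne_one]

theorem card_polys (V : Finset ℕ) : (polys V 2).card = 2 ^ (V.card + 1) := by
  induction V using Finset.induction_on with
  | empty =>
    have := sum_polys_empty fun _ => 1
    simpa using this
  | insert s V hs ih =>
    have := sum_polys_insert hs fun _ => 1
    simp only [sum_const, smul_eq_mul, mul_one] at this
    rw [this, ih, card_insert_of_notMem hs]
    ring

theorem range_succ_sdiff_of_mem {n : ℕ} {f : Finset ℕ} (h : n ∈ f) :
    range (n + 1) \ f = range n \ f := by
  rw [range_add_one, insert_sdiff_of_mem _ h]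

theorem range_succ_sdiff_of_notMem {n : ℕ} {f : Finset ℕ} (h : n ∉ f) :
    range (n + 1) \ f = insert n (range n \ f) := by
  rw [range_add_one, insert_sdiff_of_notMem _ h]

/-- Affine forms, sorted by their leading variable. -/
theorem sum_polys_range (n : ℕ) (f : Finset ℕ) (F : (ℕ → ZMod 2) → ℕ) :
    ∑ q ∈ polys (range n \ f) 2, F q =
      F 0 + F 1 + ∑ s ∈ range n \ f, ∑ h ∈ polys (range s \ f) 2, F (var s + h) := by
  induction n with
  | zero => simp [sum_polys_empty]
  | succ n ih =>
    by_cases h : n ∈ f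
    · rw [range_succ_sdiff_of_mem h, ih]
    · have h1 : n ∉ range n \ f := by simp
      rw [range_succ_sdiff_of_notMem h, sum_polys_insert h1, ih, sum_insert h1]
      ring

/-! ### The orbit of a monomial -/

/-- The products `∏ k ∈ f, (x_k + h_k)` over the variables of `f` with number below `n`, where
`h_k` is an affine form in the variables smaller than `x_k` which do not divide `f`. -/
noncomputable def orbit : ℕ → Finset ℕ → Finset (ℕ → ZMod 2)
  | 0, _ => {1}
  | n + 1, f => by
    classical exact if n ∈ f then
      (polys (range n \ f) 2 ×ˢ orbit n f).image fun x => (var n + x.1) * x.2 else orbit n f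

theorem orbit_succ_of_notMem {n : ℕ} {f : Finset ℕ} (h : n ∉ f) :
    orbit (n + 1) f = orbit n f := by simp [orbit, h]

theorem mem_orbit_succ {n : ℕ} {f : Finset ℕ} (h : n ∈ f) {p : ℕ → ZMod 2} :
    p ∈ orbit (n + 1) f ↔
      ∃ h ∈ polys (range n \ f) 2, ∃ q ∈ orbit n f, p = (var n + h) * q := by
  classical
  simp only [orbit, h, if_true, mem_image, mem_product, Prod.exists]
  constructor
  · rintro ⟨a, b, ⟨h1, h2⟩, rfl⟩; exact ⟨a, h1, b, h2, rfl⟩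
  · rintro ⟨a, h1, b, h2, rfl⟩; exact ⟨a, b, ⟨h1, h2⟩, rfl⟩

theorem orbit_congr {n : ℕ} {f f' : Finset ℕ} (h : ∀ k < n, k ∈ f ↔ k ∈ f') :
    orbit n f = orbit n f' := by
  induction n with
  | zero => rfl
  | succ n ih =>
    have h1 := ih fun k hk => h k (by omega)
    have h2 : range n \ f = range n \ f' := by
      ext k
      simp only [mem_sdiff, mem_range]
      exact and_congr_right fun hk => not_congr (h k (by omega))
    simp only [orbit, h n (by omega), h1, h2]

theorem orbit_eq_of_subset {n m : ℕ} {f : Finset ℕ} (hf : f ⊆ range n) (h : n ≤ m) :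
    orbit m f = orbit n f := by
  induction m, h using Nat.le_induction with
  | base => rfl
  | succ m hm ih =>
    rw [orbit_succ_of_notMem fun h => by have := mem_range.1 (hf h); omega, ih]

theorem orbit_dependsBelow {n : ℕ} {f : Finset ℕ} {q : ℕ → ZMod 2} (hq : q ∈ orbit n f) :
    DependsBelow n q := by
  induction n generalizing q with
  | zero =>
    rw [orbit, mem_singleton] at hq
    exact hq ▸ dependsBelow_one 0
  | succ n ih =>
    by_cases hn : n ∈ f
    · obtain ⟨h, hh, q', hq', rfl⟩ := (mem_orbit_succ hn).1 hq
      refine ((dependsBelow_var (by omega)).add ?_).mul ((ih hq').mono (by omega))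
      exact (dependsBelow_iff.2 ((polys_dependsOn hh).mono sdiff_subset)).mono (by omega)
    · rw [orbit_succ_of_notMem hn] at hq
      exact (ih hq).mono (by omega)

theorem dependsBelow_of_polys {n d : ℕ} {f : Finset ℕ} {h : ℕ → ZMod 2}
    (hh : h ∈ polys (range n \ f) d) : DependsBelow n h :=
  dependsBelow_iff.2 ((polys_dependsOn hh).mono sdiff_subset)

/-- The digits in f can be set, one after another, so that every factor of q becomes 1; h does not
see them. -/
theorem eq_zero_of_orbit_mul_eq_zero {n : ℕ} {f V : Finset ℕ} (hV : Disjoint V f)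
    {q h : ℕ → ZMod 2} (hq : q ∈ orbit n f) (hh : DependsOn V h) (h0 : q * h = 0) : h = 0 := by
  induction n generalizing q with
  | zero =>
    rw [orbit, mem_singleton] at hq
    rwa [hq, one_mul] at h0
  | succ n ih =>
    by_cases hn : n ∈ f
    · obtain ⟨h', hh', q', hq', rfl⟩ := (mem_orbit_succ hn).1 hq
      refine ih hq' (funext fun l => ?_)
      -- This value of the variable makes the factor x_n + h' equal to 1.
      obtain ⟨l', h1, h2⟩ := exists_var_eq n l (1 + h' l)
      have e1 : h' l' = h' l := dependsBelow_of_polys hh' _ _ fun k hk => h2 k (by omega)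
      have e2 : q' l' = q' l := orbit_dependsBelow hq' _ _ fun k hk => h2 k (by omega)
      have e3 : h l' = h l := hh _ _ fun k hk => h2 k fun e =>
        Finset.disjoint_left.1 hV hk (e ▸ hn)
      have e4 := congrFun h0 l'
      simp only [Pi.mul_apply, Pi.add_apply, e1, e2, e3, h1, Pi.zero_apply, add_assoc,
        CharTwo.add_self_eq_zero, add_zero, one_mul] at e4
      exact e4
    · rw [orbit_succ_of_notMem hn] at hq
      exact ih hq h0

/-- The factorization is unique: comparing x_n = 0 with x_n = 1 recovers q, and then q (h + h') = 0
forces h = h'. -/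
theorem sum_orbit_succ {n : ℕ} {f : Finset ℕ} (hn : n ∈ f) (F : (ℕ → ZMod 2) → ℕ) :
    ∑ p ∈ orbit (n + 1) f, F p =
      ∑ h ∈ polys (range n \ f) 2, ∑ q ∈ orbit n f, F ((var n + h) * q) := by
  classical
  simp only [orbit, hn, if_true]
  rw [sum_image, sum_product]
  rintro ⟨h, q⟩ h1 ⟨h', q'⟩ h2 h3
  simp only [coe_product, Set.mem_prod, mem_coe] at h1 h2 h3
  have d1 := dependsBelow_of_polys h1.1
  have d2 := dependsBelow_of_polys h2.1
  have d3 := orbit_dependsBelow h1.2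
  have d4 := orbit_dependsBelow h2.2
  have key : ∀ l z, (z + h l) * q l = (z + h' l) * q' l := fun l z => by
    obtain ⟨l', e1, e2⟩ := exists_var_eq n l z
    have e3 : ∀ k < n, l'.testBit k = l.testBit k := fun k hk => e2 k (by omega)
    have e4 := congrFun h3 l'
    simpa only [Pi.mul_apply, Pi.add_apply, e1, d1 _ _ e3, d2 _ _ e3, d3 _ _ e3, d4 _ _ e3] using e4
  have e1 : q = q' := funext fun l => by
    have a := key l 0
    have b := key l 1
    linear_combination b - a
  have e2 : q * (h + h') = 0 := funext fun l => by
    have a := key l 0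
    rw [← e1] at a
    have c := CharTwo.add_self_eq_zero (h l * q l)
    simp only [Pi.mul_apply, Pi.add_apply, Pi.zero_apply]
    linear_combination c - a
  have e3 := eq_zero_of_orbit_mul_eq_zero (f := f) sdiff_disjoint h1.2
    (polys_dependsOn (add_mem_polys h1.1 h2.1)) e2
  have e4 : h = h' := by
    have := congrArg (· + h') e3
    simpa only [add_assoc, fun_add_self, add_zero, zero_add] using this
  rw [e1, e4]

theorem filter_lt_succ_of_mem {n : ℕ} {f : Finset ℕ} (hn : n ∈ f) :
    f.filter (· < n + 1) = insert n (f.filter (· < n)) := by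
  ext k
  simp only [mem_filter, mem_insert]
  constructor
  · rintro ⟨a, b⟩
    by_cases h : k = n
    · exact Or.inl h
    · exact Or.inr ⟨a, by omega⟩
  · rintro (rfl | ⟨a, b⟩)
    · exact ⟨hn, by omega⟩
    · exact ⟨a, by omega⟩

theorem filter_lt_succ_of_notMem {n : ℕ} {f : Finset ℕ} (hn : n ∉ f) :
    f.filter (· < n + 1) = f.filter (· < n) :=
  filter_congr fun k hk => by
    have : k ≠ n := fun e => hn (e ▸ hk)
    omega

/-- The affine forms for distinct variables of f are chosen independently; the exponents count their
coefficients, constant term included. -/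
theorem card_orbit (n : ℕ) (f : Finset ℕ) :
    (orbit n f).card =
      2 ^ ∑ k ∈ f.filter (· < n), (k - (f.filter (· < k)).card + 1) := by
  induction n with
  | zero => simp [orbit]
  | succ n ih =>
    by_cases hn : n ∈ f
    · have h1 := sum_orbit_succ hn fun _ => 1
      simp only [sum_const, smul_eq_mul, mul_one] at h1
      have h2 := filter_lt_succ_of_mem hn
      have h3 : (range n \ f).card = n - (f.filter (· < n)).card := by
        rw [card_sdiff, card_range]
        congr 2
        ext k
        simp
      rw [h1, card_polys, ih, h2, sum_insert (by simp), h3, pow_add (2 : ℕ) (_ + 1)]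
    · rw [orbit_succ_of_notMem hn, ih]
      rw [filter_lt_succ_of_notMem hn]

theorem card_filter_lt_succ_of_mem {n : ℕ} {f : Finset ℕ} (hn : n ∈ f) :
    (f.filter (· < n + 1)).card = (f.filter (· < n)).card + 1 := by
  rw [filter_lt_succ_of_mem hn, card_insert_of_notMem (by simp)]

theorem card_filter_lt_le (n : ℕ) (f : Finset ℕ) : (f.filter (· < n)).card ≤ n :=
  card_add_le_of_subset fun _ hk => mem_range.2 (mem_filter.1 hk).2

theorem filter_lt_eq_self {n : ℕ} {f : Finset ℕ} (hf : f ⊆ range n) : f.filter (· < n) = f :=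
  filter_true_of_mem fun _ hk => mem_range.1 (hf hk)

/-- For given smaller digits exactly one value of x_n makes x_n + h equal to 1, so the two halves
together weigh as much as the remaining factor. -/
theorem pw_orbit {n : ℕ} {f : Finset ℕ} {q : ℕ → ZMod 2} (hq : q ∈ orbit n f) :
    pw (2 ^ n) q = 2 ^ (n - (f.filter (· < n)).card) := by
  induction n generalizing q with
  | zero =>
    rw [orbit, mem_singleton] at hq
    simp [hq, pw_one_one]
  | succ n ih =>
    by_cases hn : n ∈ f
    · obtain ⟨h, hh, q', hq', rfl⟩ := (mem_orbit_succ hn).1 hq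
      have d := (dependsBelow_of_polys hh).mul (orbit_dependsBelow hq')
      have e : (var n + h) * q' = h * q' + var n * q' := by ring
      rw [e, pw_two_pow_succ d, card_filter_lt_succ_of_mem hn, Nat.add_sub_add_right, ← ih hq']
      unfold pw
      rw [← sum_add_distrib]
      refine sum_congr rfl fun l _ => ?_
      have : ∀ x y : ZMod 2, (x * y + y).val + (x * y).val = y.val := by decide
      exact this _ _
    · rw [orbit_succ_of_notMem hn] at hq
      rw [pw_two_pow_succ_of_dependsBelow (orbit_dependsBelow hq), ih hq,
        filter_lt_succ_of_notMem hn, Nat.succ_sub (card_filter_lt_le n f), pow_succ]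
      ring

theorem sum_sum_mul_sum {α β γ : Type} (A : Finset α) (B : Finset β) (C : Finset γ) (c : ℕ)
    (G : α → β → γ → ℕ) : ∑ a ∈ A, ∑ b ∈ B, c * ∑ d ∈ C, G a b d =
      c * ∑ d ∈ C, ∑ a ∈ A, ∑ b ∈ B, G a b d := by
  simp only [← mul_sum]
  rw [sum_comm (s := C)]
  exact congrArg _ (sum_congr rfl fun a _ => sum_comm)

/-- Multiplying the orbit of `f` by the affine forms with leading variable `x_s` gives the orbit of
`f * x_s`, each element with the same multiplicity. -/
theorem sum_orbit_insert {n s : ℕ} (hs : s < n) {f : Finset ℕ} (hsf : s ∉ f)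
    (F : (ℕ → ZMod 2) → ℕ) :
    ∑ h ∈ polys (range s \ f) 2, ∑ q ∈ orbit n f, F ((var s + h) * q) =
      2 ^ (f.filter fun k => s < k ∧ k < n).card * ∑ p ∈ orbit n (insert s f), F p := by
  induction n generalizing F with
  | zero => omega
  | succ n ih =>
    rcases Nat.lt_succ_iff_lt_or_eq.1 hs with hs' | rfl
    · by_cases hn : n ∈ f
      · have hn' : n ∈ insert s f := mem_insert_of_mem hn
        have hins : range n \ f = insert s (range n \ insert s f) := by
          ext k
          simp only [mem_sdiff, mem_range, mem_insert]
          constructor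
          · rintro ⟨a, b⟩
            by_cases h : k = s
            · exact Or.inl h
            · exact Or.inr ⟨a, by simp [h, b]⟩
          · rintro (rfl | ⟨a, b⟩)
            · exact ⟨hs', hsf⟩
            · exact ⟨a, fun h => b (Or.inr h)⟩
        have hsub : range s \ f ⊆ range n \ insert s f := fun k hk => by
          simp only [mem_sdiff, mem_range, mem_insert] at hk ⊢
          exact ⟨by omega, by rintro (rfl | h) <;> [omega; exact hk.2 h]⟩
        have hcard : (f.filter fun k => s < k ∧ k < n + 1).card =
            (f.filter fun k => s < k ∧ k < n).card + 1 := by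
          have h2 : (f.filter fun k => s < k ∧ k < n + 1) =
              insert n (f.filter fun k => s < k ∧ k < n) := by
            ext k
            simp only [mem_filter, mem_insert]
            constructor
            · rintro ⟨a, b⟩
              by_cases h : k = n
              · exact Or.inl h
              · exact Or.inr ⟨a, by omega⟩
            · rintro (rfl | ⟨a, b⟩)
              · exact ⟨hn, by omega⟩
              · exact ⟨a, by omega⟩
          rw [h2, card_insert_of_notMem (by simp)]
        have step : ∀ h ∈ polys (range s \ f) 2, ∀ q : ℕ → ZMod 2,
            ∑ h' ∈ polys (range n \ f) 2, F ((var s + h) * ((var n + h') * q)) =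
              2 * ∑ h' ∈ polys (range n \ insert s f) 2,
                F ((var n + h') * ((var s + h) * q)) := fun h hh q => by
          -- Where x_s + h is nonzero, x_s equals h + 1. Hence the forms h' containing x_s reduce to
          -- x_s-free ones shifted by h + 1, and each x_s-free form is met twice.
          have h1 : h + 1 ∈ polys (range n \ insert s f) 2 :=
            add_mem_polys (polys_mono hsub 2 hh) (one_mem_polys _)
          rw [hins, sum_polys_insert (by simp), ← sum_polys_add h1
            (fun h' => F ((var s + h) * ((var n + (var s + h')) * q))), two_mul]
          congr 1
          · refine sum_congr rfl fun h' _ => ?_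
            congr 1
            ring
          · refine sum_congr rfl fun h' _ => ?_
            congr 1
            funext l
            simp only [Pi.mul_apply, Pi.add_apply, Pi.one_apply]
            generalize var s l = a
            generalize var n l = b
            generalize h l = c
            generalize h' l = d
            generalize q l = e
            revert a b c d e
            decide
        rw [sum_orbit_succ hn', hcard, pow_succ]
        have ih' := fun h' : ℕ → ZMod 2 => ih hs' fun p => F ((var n + h') * p)
        calc _ = ∑ h ∈ polys (range s \ f) 2, ∑ q ∈ orbit n f,
              ∑ h' ∈ polys (range n \ f) 2, F ((var s + h) * ((var n + h') * q)) := by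
              refine sum_congr rfl fun h _ => ?_
              rw [sum_orbit_succ hn]
              exact sum_comm
          _ = ∑ h ∈ polys (range s \ f) 2, ∑ q ∈ orbit n f,
              2 * ∑ h' ∈ polys (range n \ insert s f) 2,
                F ((var n + h') * ((var s + h) * q)) :=
              sum_congr rfl fun h hh => sum_congr rfl fun q _ => step h hh q
          _ = 2 * ∑ h' ∈ polys (range n \ insert s f) 2, ∑ h ∈ polys (range s \ f) 2,
              ∑ q ∈ orbit n f, F ((var n + h') * ((var s + h) * q)) := sum_sum_mul_sum _ _ _ _ _
          _ = _ := by
              rw [sum_congr rfl fun h' _ => ih' h', ← mul_sum]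
              ring
      · have hn' : n ∉ insert s f := by
          rw [mem_insert]
          rintro (rfl | h)
          · omega
          · exact hn h
        rw [orbit_succ_of_notMem hn, orbit_succ_of_notMem hn', ih hs']
        congr 3
        refine filter_congr fun k hk => ?_
        have : k ≠ n := fun e => hn (e ▸ hk)
        omega
    · have h1 : orbit s (insert s f) = orbit s f := orbit_congr fun k hk => by
        rw [mem_insert]
        exact ⟨fun h => h.resolve_left (by omega), Or.inr⟩
      have h2 : range s \ insert s f = range s \ f := by
        ext k
        simp only [mem_sdiff, mem_range, mem_insert]
        constructor
        · rintro ⟨a, b⟩; exact ⟨a, fun h => b (Or.inr h)⟩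
        · rintro ⟨a, b⟩; exact ⟨a, by rintro (rfl | h) <;> [omega; exact b h]⟩
      have h3 : (f.filter fun k => s < k ∧ k < s + 1) = ∅ :=
        filter_false_of_mem fun k _ => by omega
      rw [orbit_succ_of_notMem hsf, sum_orbit_succ (mem_insert_self s f), h1, h2, h3]
      simp

theorem poly_apply_of_var_eq {n : ℕ} {S : Finset (Finset ℕ)} (hS : ∀ g ∈ S, g ⊆ range (n + 1))
    {l l' : ℕ} (h : ∀ k ≠ n, l'.testBit k = l.testBit k) :
    poly S l' = poly (lowPart n S) l + var n l' * poly (highPart n S) l := by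
  have e : ∀ k < n, l'.testBit k = l.testBit k := fun k hk => h k (by omega)
  conv_lhs => rw [poly_split n S]
  simp only [Pi.add_apply, Pi.mul_apply]
  rw [dependsBelow_poly (lowPart_subset_range hS) _ _ e,
    dependsBelow_poly (highPart_subset_range hS) _ _ e]

theorem poly_mem_polys_insert {V : Finset ℕ} {n d : ℕ} (hn : n ∉ V) {p q : ℕ → ZMod 2}
    (hp : p ∈ polys V (d + 1)) (hq : q ∈ polys V d) :
    p + var n * q ∈ polys (insert n V) (d + 1) := by
  obtain ⟨S, hS, rfl⟩ := mem_polys.1 hq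
  refine add_mem_polys (polys_mono (subset_insert n V) _ hp) (mem_polys.2 ⟨lift n S, ?_, ?_⟩)
  · intro g hg
    obtain ⟨g', hg', rfl⟩ := mem_image.1 hg
    have h1 := hS g' hg'
    exact ⟨insert_subset_insert n h1.1, (card_insert_le n g').trans_lt (by omega)⟩
  · exact poly_lift fun g hg h => hn ((hS g hg).1 h)

/-- A polynomial which vanishes where a product `b` of affine forms does is a multiple of `b`, with
a cofactor of the expected degree. -/
theorem exists_eq_mul_of_support {n e : ℕ} {f : Finset ℕ} {b : ℕ → ZMod 2} (hb : b ∈ orbit n f)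
    {S : Finset (Finset ℕ)} (hS : ∀ g ∈ S, g ⊆ range n)
    (hd : ∀ g ∈ S, g.card < (f.filter (· < n)).card + e) (h0 : ∀ l, b l = 0 → poly S l = 0) :
    ∃ h ∈ polys (range n \ f) e, poly S = b * h := by
  induction n generalizing e b S with
  | zero =>
    rw [orbit, mem_singleton] at hb
    subst hb
    refine ⟨poly S, mem_polys.2 ⟨S, fun g hg => ⟨by simpa using hS g hg, ?_⟩, rfl⟩, by simp⟩
    simpa using hd g hg
  | succ n ih =>
    have hlow := lowPart_subset_range hS
    have hhigh := highPart_subset_range hS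
    have hdlow : ∀ g ∈ lowPart n S, g.card < (f.filter (· < n + 1)).card + e := fun g hg =>
      hd g (mem_lowPart.1 hg).1
    have hdhigh : ∀ g ∈ highPart n S, g.card + 1 < (f.filter (· < n + 1)).card + e := by
      intro g hg
      have := hd _ (mem_highPart.1 hg).2
      rwa [card_insert_of_notMem (mem_highPart.1 hg).1] at this
    by_cases hn : n ∈ f
    · obtain ⟨h', hh', b', hb', rfl⟩ := (mem_orbit_succ hn).1 hb
      -- The digit n of l is free, so z may be any value of the variable.
      have key : ∀ l z, (z + h' l) * b' l = 0 →
          poly (lowPart n S) l + z * poly (highPart n S) l = 0 := fun l z hz => by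
        obtain ⟨l', e1, e2⟩ := exists_var_eq n l z
        have e3 : ∀ k < n, l'.testBit k = l.testBit k := fun k hk => e2 k (by omega)
        rw [← e1, ← poly_apply_of_var_eq hS e2]
        refine h0 l' ?_
        simpa only [Pi.mul_apply, Pi.add_apply, e1, dependsBelow_of_polys hh' _ _ e3,
          orbit_dependsBelow hb' _ _ e3] using hz
      obtain ⟨h, hh, hH⟩ := ih (e := e) hb' hhigh
        (fun g hg => by
          have := hdhigh g hg
          rw [card_filter_lt_succ_of_mem hn] at this
          omega)
        (fun l hl => by
          have a := key l 0 (by simp [hl])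
          have b := key l 1 (by simp [hl])
          linear_combination b - a)
      refine ⟨h, by rwa [range_succ_sdiff_of_mem hn], ?_⟩
      -- Choosing z = h' annihilates the factor x_n + h', so the low part is determined by the high
      -- part, and both share one cofactor h.
      have hl : poly (lowPart n S) = h' * poly (highPart n S) := funext fun l => by
        have a := key l (h' l) (by rw [CharTwo.add_self_eq_zero, zero_mul])
        exact CharTwo.add_eq_zero.1 a
      rw [poly_split n S, hl, hH]
      ring
    · have hb' := hb
      rw [orbit_succ_of_notMem hn] at hb'
      rw [filter_lt_succ_of_notMem hn] at hdlow hdhigh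
      have key : ∀ l z, b l = 0 →
          poly (lowPart n S) l + z * poly (highPart n S) l = 0 := fun l z hz => by
        obtain ⟨l', e1, e2⟩ := exists_var_eq n l z
        have e3 : ∀ k < n, l'.testBit k = l.testBit k := fun k hk => e2 k (by omega)
        rw [← e1, ← poly_apply_of_var_eq hS e2]
        exact h0 l' (by rwa [orbit_dependsBelow hb' _ _ e3])
      have z0 : ∀ l, b l = 0 → poly (lowPart n S) l = 0 := fun l hl => by simpa using key l 0 hl
      have z1 : ∀ l, b l = 0 → poly (highPart n S) l = 0 := fun l hl => by
        linear_combination key l 1 hl - key l 0 hl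
      obtain ⟨h1, hh1, e1⟩ := ih hb' hlow hdlow z0
      -- The high part has one degree less to spend; for e = 0 no nonzero cofactor is possible at
      -- all.
      rcases e with _ | e
      · obtain ⟨h2, hh2, e2⟩ := ih (e := 0) hb' hhigh
          (fun g hg => by have := hdhigh g hg; omega) z1
        have hz : ∀ q ∈ polys (range n \ f) 0, q = 0 := fun q hq => by
          obtain ⟨S', hS', rfl⟩ := mem_polys.1 hq
          have : S' = ∅ := eq_empty_of_forall_notMem fun g hg => by
            have := (hS' g hg).2
            omega
          simp [this]
        refine ⟨0, zero_mem_polys _ _, ?_⟩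
        rw [poly_split n S, e1, e2, hz _ hh1, hz _ hh2]
        simp
      · obtain ⟨h2, hh2, e2⟩ := ih (e := e) hb' hhigh
          (fun g hg => by have := hdhigh g hg; omega) z1
        refine ⟨h1 + var n * h2, ?_, ?_⟩
        · rw [range_succ_sdiff_of_notMem hn]
          exact poly_mem_polys_insert (by simp) hh1 hh2
        · rw [poly_split n S, e1, e2]
          ring

/-- The polynomials of minimum weight among those with leading monomial `f` and degree at most
that of `f` lie in the orbit of `f`. -/
theorem poly_mem_orbit {n : ℕ} {S : Finset (Finset ℕ)} (hS : ∀ g ∈ S, g ⊆ range n)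
    {f : Finset ℕ} (hf : f ∈ S) (hmax : ∀ g ∈ S, binVal g ≤ binVal f)
    (hdeg : ∀ g ∈ S, g.card ≤ f.card) (hw : pw (2 ^ n) (poly S) = 2 ^ (n - f.card)) :
    poly S ∈ orbit n f := by
  induction n generalizing S f with
  | zero =>
    obtain ⟨rfl, rfl⟩ := eq_singleton_empty hS hf
    simp [orbit, poly_singleton_empty]
  | succ n ih =>
    by_cases hn : n ∈ f
    · have hlow := lowPart_subset_range hS
      have hhigh := highPart_subset_range hS
      obtain ⟨h1, h2⟩ := leading_highPart hf hn hmax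
      have hc : (f.erase n).card + 1 = f.card := card_erase_add_one hn
      have hcard : n + 1 - f.card = n - (f.erase n).card := by omega
      have h3 := two_pow_le_pw_poly hhigh h1 h2
      have h4 := pw_le_add (2 ^ n) (poly (lowPart n S)) (poly (highPart n S))
      have hw' := hw
      rw [poly_split n S, pw_two_pow_succ (dependsBelow_poly hlow), hcard] at hw'
      have hb : poly (highPart n S) ∈ orbit n (f.erase n) := by
        refine ih hhigh h1 h2 (fun g hg => ?_) (by omega)
        have := hdeg _ (mem_highPart.1 hg).2
        rw [card_insert_of_notMem (mem_highPart.1 hg).1] at this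
        omega
      have hr : f.erase n ⊆ range n := hhigh _ h1
      -- The low part has degree at most that of f, one more than the number of factors of the high
      -- part, so the cofactor is affine.
      obtain ⟨h, hh, e⟩ := exists_eq_mul_of_support (e := 2) hb hlow
        (fun g hg => by
          rw [filter_lt_eq_self hr]
          have := hdeg g (mem_lowPart.1 hg).1
          omega)
        (fun l hl => by
          have d1 := (dependsBelow_poly hlow).mod l
          have d2 := (dependsBelow_poly hhigh).mod l
          rw [← d1]
          exact eq_zero_of_pw_add_eq (q := poly (highPart n S)) (a := 2 ^ n) (by omega)
            (Nat.mod_lt _ (by positivity)) (by rw [d2, hl]))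
      refine (mem_orbit_succ hn).2 ⟨h, ?_, poly (highPart n S), ?_, ?_⟩
      · convert hh using 2
        ext k
        simp only [mem_sdiff, mem_range, mem_erase]
        constructor
        · rintro ⟨a, b⟩; exact ⟨a, fun h => b h.2⟩
        · rintro ⟨a, b⟩; exact ⟨a, fun h => b ⟨by omega, h⟩⟩
      · rw [orbit_congr (f' := f.erase n) fun k hk => by simp [hk.ne]]
        exact hb
      · conv_lhs => rw [poly_split n S, e]
        ring
    · have h1 := notMem_of_leading hS hf hn hmax
      rw [orbit_succ_of_notMem hn]
      refine ih h1 hf hmax hdeg ?_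
      rw [pw_two_pow_succ_of_dependsBelow (dependsBelow_poly h1),
        Nat.succ_sub (card_add_le_of_subset (h1 f hf)), pow_succ] at hw
      omega

/-! ### Expansion of the orbit elements -/

/-- `g` has at most as many variables from `x_{k+1}` on as `f`, for every `k`. -/
def Dominated (g f : Finset ℕ) : Prop :=
  ∀ x : ℕ, (g.filter fun k => x ≤ k).card ≤ (f.filter fun k => x ≤ k).card

theorem mon_mul_mon (a b : Finset ℕ) : mon a * mon b = mon (a ∪ b) := by
  have h : mon (a ∩ b) * mon (a ∩ b) = mon (a ∩ b) := funext fun l => by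
    simp only [Pi.mul_apply]
    generalize mon (a ∩ b) l = z
    revert z; decide
  have h1 : mon a = mon (a \ b) * mon (a ∩ b) := by
    rw [mul_comm]; exact (prod_inter_mul_prod_sdiff a b var).symm
  have h2 : mon b = mon (b \ a) * mon (a ∩ b) := by
    rw [mul_comm, inter_comm]; exact (prod_inter_mul_prod_sdiff b a var).symm
  have h3 : a ∪ b = (a \ b ∪ b \ a) ∪ (a ∩ b) := by
    ext k; simp only [mem_union, mem_sdiff, mem_inter]; tauto
  have h4 : mon (a ∪ b) = mon (a \ b) * mon (b \ a) * mon (a ∩ b) := by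
    rw [h3]
    unfold mon
    rw [prod_union, prod_union disjoint_sdiff_sdiff]
    rw [Finset.disjoint_left]
    intro k
    simp only [mem_union, mem_sdiff, mem_inter]
    tauto
  rw [h4, h1, h2]
  linear_combination (mon (a \ b) * mon (b \ a)) * h

theorem exists_poly_eq_sum {ι : Type} (s : Finset ι) (g : ι → Finset ℕ) :
    ∃ S : Finset (Finset ℕ), (∀ a ∈ S, ∃ x ∈ s, a = g x) ∧ poly S = ∑ x ∈ s, mon (g x) := by
  classical
  induction s using Finset.induction_on with
  | empty => exact ⟨∅, by simp, by simp⟩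
  | insert x s hx ih =>
    obtain ⟨S, h1, h2⟩ := ih
    refine ⟨symmDiff {g x} S, fun a ha => ?_, ?_⟩
    · rcases mem_symmDiff.1 ha with h | h
      · exact ⟨x, mem_insert_self _ _, mem_singleton.1 h.1⟩
      · obtain ⟨y, hy, e⟩ := h1 a h.1
        exact ⟨y, mem_insert_of_mem hy, e⟩
    · rw [poly_symmDiff, h2, sum_insert hx]
      simp [poly]

theorem exists_poly_eq_mul (S S' : Finset (Finset ℕ)) :
    ∃ S'' : Finset (Finset ℕ), (∀ a ∈ S'', ∃ g ∈ S, ∃ g' ∈ S', a = g ∪ g') ∧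
      poly S'' = poly S * poly S' := by
  obtain ⟨S'', h1, h2⟩ := exists_poly_eq_sum (S ×ˢ S') fun x => x.1 ∪ x.2
  refine ⟨S'', fun a ha => ?_, ?_⟩
  · obtain ⟨x, hx, e⟩ := h1 a ha
    rw [mem_product] at hx
    exact ⟨x.1, hx.1, x.2, hx.2, e⟩
  · rw [h2, sum_product]
    simp only [poly, sum_mul_sum, mon_mul_mon]

/-- The set a adds at most one variable, not larger than n, so it raises only counts which n raises
too. -/
theorem Dominated.union_insert {n : ℕ} {a g f : Finset ℕ} (ha : ∀ k ∈ a, k ≤ n)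
    (hcard : a.card < 2) (hn : n ∉ f) (h : Dominated g f) :
    Dominated (a ∪ g) (insert n f) := fun x => by
  rw [filter_union, filter_insert]
  refine (card_union_le _ _).trans ?_
  have h1 := h x
  split_ifs with hx
  · rw [card_insert_of_notMem (by simp [hn])]
    have := card_filter_le a fun k => x ≤ k
    omega
  · have : a.filter (fun k => x ≤ k) = ∅ := filter_false_of_mem fun k hk => by
      have := ha k hk
      omega
    rw [this, card_empty]
    omega

/-- Each term arises from f by keeping some variables x_k and replacing the others by a smaller
variable or by 1; only the choice of all x_k gives f itself. -/
theorem orbit_expansion {n : ℕ} {f : Finset ℕ} (hf : f ⊆ range n) {p : ℕ → ZMod 2}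
    (hp : p ∈ orbit n f) : ∃ S : Finset (Finset ℕ), f ∈ S ∧
      (∀ g ∈ S, g ⊆ range n ∧ Dominated g f ∧ binVal g ≤ binVal f) ∧ poly S = p := by
  induction n generalizing f p with
  | zero =>
    rw [orbit, mem_singleton] at hp
    have : f = ∅ := by simpa using hf
    subst this
    exact ⟨{∅}, by simp, by simp [Dominated], by rw [hp, poly_singleton_empty]⟩
  | succ n ih =>
    by_cases hn : n ∈ f
    · obtain ⟨h, hh, q, hq, rfl⟩ := (mem_orbit_succ hn).1 hp
      have hr : f.erase n ⊆ range n := subset_range_of_succ ((erase_subset n f).trans hf) (by simp)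
      rw [orbit_congr (f' := f.erase n) fun k hk => by simp [hk.ne]] at hq
      obtain ⟨S, h1, h2, rfl⟩ := ih hr hq
      obtain ⟨H, h3, rfl⟩ := mem_polys.1 hh
      obtain ⟨S', h4, h5⟩ := exists_poly_eq_mul H S
      have hnS : ∀ g ∈ S, n ∉ g := fun g hg => notMem_of_subset_range (h2 g hg).1
      have hS' : ∀ g ∈ S', g ⊆ range n := fun g hg => by
        obtain ⟨a, ha, b, hb, rfl⟩ := h4 g hg
        exact union_subset ((h3 a ha).1.trans sdiff_subset) (h2 b hb).1
      have hfe : insert n (f.erase n) = f := insert_erase hn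
      refine ⟨lift n S ∪ S', mem_union_left _ (mem_image.2 ⟨_, h1, hfe⟩), fun g hg => ?_, ?_⟩
      · rcases mem_union.1 hg with hg | hg
        · obtain ⟨g', hg', rfl⟩ := mem_image.1 hg
          refine ⟨?_, ?_, ?_⟩
          · rw [range_add_one]
            exact insert_subset_insert n (h2 g' hg').1
          · rw [← hfe, insert_eq]
            exact (h2 g' hg').2.1.union_insert (by simp) (by simp) (by simp)
          · rw [binVal_insert (hnS g' hg'), ← hfe, binVal_insert (notMem_erase n f)]
            have := (h2 g' hg').2.2
            omega
        · refine ⟨(hS' g hg).trans (range_subset_range.2 (by omega)), ?_, ?_⟩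
          · obtain ⟨a, ha, b, hb, rfl⟩ := h4 g hg
            rw [← hfe]
            refine (h2 b hb).2.1.union_insert (fun k hk => ?_) (h3 a ha).2 (by simp)
            have := (mem_sdiff.1 ((h3 a ha).1 hk)).1
            rw [mem_range] at this
            omega
          · exact (binVal_lt (hS' g hg)).le.trans (two_pow_le_binVal hn)
      · rw [poly_union, poly_lift hnS, h5]
        · ring
        · rw [Finset.disjoint_left]
          intro g hg hg'
          obtain ⟨g', _, rfl⟩ := mem_image.1 hg
          exact notMem_of_subset_range (hS' _ hg') (mem_insert_self _ _)
    · rw [orbit_succ_of_notMem hn] at hp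
      obtain ⟨S, h1, h2, h3⟩ := ih (subset_range_of_succ hf hn) hp
      exact ⟨S, h1, fun g hg => ⟨(h2 g hg).1.trans (range_subset_range.2 (by omega)),
        (h2 g hg).2⟩, h3⟩

/-! ### Reversal of the positions -/

/-- The reversal of each period of length `2 ^ n`. -/
def reversal (n l : ℕ) : ℕ := 2 ^ n - (l % 2 ^ n + 1)

theorem testBit_reversal {n k : ℕ} (hk : k < n) (l : ℕ) :
    (reversal n l).testBit k = !l.testBit k := by
  rw [reversal, Nat.testBit_two_pow_sub_succ (Nat.mod_lt _ (by positivity)),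
    Nat.testBit_mod_two_pow]
  simp [hk]

theorem var_reversal {n k : ℕ} (hk : k < n) (l : ℕ) : var k (reversal n l) = var k l + 1 := by
  simp only [var, testBit_reversal hk]
  cases l.testBit k
  · simp; decide
  · simp

theorem polys_reversal {n m : ℕ} (hnm : n ≤ m) {f : Finset ℕ} {h : ℕ → ZMod 2}
    (hh : h ∈ polys (range n \ f) 2) : h ∘ reversal m ∈ polys (range n \ f) 2 := by
  obtain ⟨S, hS, rfl⟩ := mem_polys.1 hh
  have e : poly S ∘ reversal m = ∑ g ∈ S, (mon g ∘ reversal m) := by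
    funext l; simp [poly]
  rw [e]
  refine sum_induction _ (· ∈ polys (range n \ f) 2) (fun _ _ => add_mem_polys)
    (zero_mem_polys _ _) fun g hg => ?_
  obtain ⟨h1, h2⟩ := hS g hg
  rcases card_le_one_iff_subset_singleton.1 (Nat.le_of_lt_succ h2) with ⟨k, hk⟩
  rcases subset_singleton_iff.1 hk with rfl | rfl
  · exact one_mem_polys _
  · have hk' := h1 (mem_singleton_self k)
    have : mon {k} ∘ reversal m = var k + 1 := funext fun l => by
      have := mem_range.1 (mem_sdiff.1 hk').1
      simp [mon, var_reversal (show k < m by omega)]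
    rw [this]
    exact add_mem_polys (var_mem_polys hk') (one_mem_polys _)

/-- Reversal replaces each variable x_k by x_k + 1; the extra constant is absorbed into the affine
form h_k. -/
theorem orbit_reversal {n m : ℕ} (hnm : n ≤ m) {f : Finset ℕ} {q : ℕ → ZMod 2}
    (hq : q ∈ orbit n f) : q ∘ reversal m ∈ orbit n f := by
  induction n generalizing q with
  | zero =>
    rw [orbit, mem_singleton] at hq ⊢
    rw [hq]
    rfl
  | succ n ih =>
    by_cases hn : n ∈ f
    · obtain ⟨h, hh, q', hq', rfl⟩ := (mem_orbit_succ hn).1 hq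
      refine (mem_orbit_succ hn).2 ⟨_, add_mem_polys (polys_reversal (m := m) (by omega) hh)
        (one_mem_polys _), _, ih (by omega) hq', funext fun l => ?_⟩
      simp only [Function.comp_apply, Pi.mul_apply, Pi.add_apply, Pi.one_apply,
        var_reversal (show n < m by omega)]
      ring
    · rw [orbit_succ_of_notMem hn] at hq ⊢
      exact ih (by omega) hq

theorem comp_reversal_comp_reversal {n : ℕ} {q : ℕ → ZMod 2} (hq : DependsBelow n q) :
    (q ∘ reversal n) ∘ reversal n = q := funext fun l => by
  refine hq _ _ fun k hk => ?_
  rw [testBit_reversal hk, testBit_reversal hk, Bool.not_not]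

theorem pw_add_pw_reversal {n a : ℕ} (ha : a ≤ 2 ^ n) (q : ℕ → ZMod 2) :
    pw a q + pw (2 ^ n - a) (q ∘ reversal n) = pw (2 ^ n) q := by
  conv_rhs => rw [← Nat.add_sub_cancel' ha, pw_add_left]
  congr 1
  unfold pw
  rw [← sum_range_reflect fun l => (q (a + l)).val]
  refine sum_congr rfl fun l hl => ?_
  have hl' := mem_range.1 hl
  rw [Function.comp_apply, reversal, Nat.mod_eq_of_lt (by omega)]
  congr 2
  omega

/-! ### The number of orbit elements of given prefix weight -/

/-- The number of elements of the orbit of `f` with `w` ones among the first `a` values. -/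
noncomputable def orbitCount (m : ℕ) (f : Finset ℕ) (w : ℤ) (a : ℕ) : ℕ :=
  ((orbit m f).filter fun p => (pw a p : ℤ) = w).card

theorem orbitCount_eq_sum (m : ℕ) (f : Finset ℕ) (w : ℤ) (a : ℕ) :
    orbitCount m f w a = ∑ p ∈ orbit m f, if (pw a p : ℤ) = w then 1 else 0 := card_filter _ _

/-- On the prefix x_j is 1, so the last factor is the affine form h + 1. The forms are sorted by
leading variable; the form 0 drops out because w is nonzero. -/
theorem orbitCount_of_le_half {j a : ℕ} {f : Finset ℕ} (hf : f ⊆ range (j + 1)) (hj : j ∈ f)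
    (ha : a ≤ 2 ^ j) {w : ℤ} (hw : w ≠ 0) :
    orbitCount (j + 1) f w a = ∑ s ∈ range j \ f,
      2 ^ ((f.erase j).filter fun k => s < k).card *
        orbitCount (j + 1) (insert s (f.erase j)) w a + orbitCount (j + 1) (f.erase j) w a := by
  set F : (ℕ → ZMod 2) → ℕ := fun p => if (pw a p : ℤ) = w then 1 else 0 with hF
  have hr : f.erase j ⊆ range j := subset_range_of_succ ((erase_subset j f).trans hf) (by simp)
  have horb : orbit j f = orbit j (f.erase j) := orbit_congr fun k hk => by simp [hk.ne]
  have hF0 : F 0 = 0 := by simp [hF, hw.symm]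
  have e1 : ∀ h q, F ((var j + h) * q) = F ((h + 1) * q) := fun h q => by
    have : pw a ((var j + h) * q) = pw a ((h + 1) * q) := pw_congr fun l hl => by
      simp [var_of_lt (hl.trans_le ha), add_comm]
    simp only [hF, this]
  have hc : ∀ g, orbitCount (j + 1) g w a = ∑ p ∈ orbit (j + 1) g, F p := fun g =>
    orbitCount_eq_sum _ _ _ _
  simp only [hc]
  rw [sum_orbit_succ hj, horb]
  simp only [e1]
  have hsdiff : range j \ f = range j \ f.erase j := by
    ext k
    simp only [mem_sdiff, mem_range, mem_erase]
    constructor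
    · rintro ⟨a, b⟩; exact ⟨a, fun h => b h.2⟩
    · rintro ⟨a, b⟩; exact ⟨a, fun h => b ⟨by omega, h⟩⟩
  rw [sum_polys_add (one_mem_polys _) fun h => ∑ q ∈ orbit j (f.erase j), F (h * q), hsdiff,
    sum_polys_range]
  simp only [zero_mul, hF0, sum_const_zero, zero_add, one_mul]
  rw [add_comm, orbit_eq_of_subset hr (Nat.le_succ j)]
  congr 1
  refine sum_congr rfl fun s hs => ?_
  rw [mem_sdiff, mem_range] at hs
  rw [sum_orbit_insert hs.1 hs.2, orbit_eq_of_subset (n := j) _ (Nat.le_succ j)]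
  · congr 3
    refine filter_congr fun k hk => ?_
    have := mem_range.1 (hr hk)
    omega
  · exact insert_subset (mem_range.2 hs.1) hr

/-- All orbit elements have the same total weight, and the suffix of one is the reversed prefix of
another. -/
theorem orbitCount_reversal {n a : ℕ} (ha : a ≤ 2 ^ n) {f : Finset ℕ} (hf : f ⊆ range n) (w : ℤ) :
    orbitCount n f w a = orbitCount n f (2 ^ (n - f.card) - w) (2 ^ n - a) := by
  have key : ∀ p ∈ orbit n f, (pw a p : ℤ) + pw (2 ^ n - a) (p ∘ reversal n) =
      2 ^ (n - f.card) := fun p hp => by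
    have h1 := pw_add_pw_reversal ha p
    rw [pw_orbit hp, filter_lt_eq_self hf] at h1
    exact_mod_cast h1
  rw [orbitCount_eq_sum, orbitCount_eq_sum]
  refine sum_bij' (fun p _ => p ∘ reversal n) (fun p _ => p ∘ reversal n)
    (fun p hp => orbit_reversal le_rfl hp) (fun p hp => orbit_reversal le_rfl hp)
    (fun p hp => comp_reversal_comp_reversal (orbit_dependsBelow hp))
    (fun p hp => comp_reversal_comp_reversal (orbit_dependsBelow hp)) fun p hp => ?_
  have := key p hp
  refine if_congr ?_ rfl rfl
  constructor <;> intro h <;> omega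

theorem orbitCount_two_pow_add (n a : ℕ) {f : Finset ℕ} (hf : f ⊆ range n) (w : ℤ) :
    orbitCount n f w (2 ^ n + a) = orbitCount n f (w - 2 ^ (n - f.card)) a := by
  rw [orbitCount_eq_sum, orbitCount_eq_sum]
  refine sum_congr rfl fun p hp => ?_
  have h1 : pw (2 ^ n + a) p = 2 ^ (n - f.card) + pw a p := by
    rw [pw_add_left, pw_orbit hp, filter_lt_eq_self hf]
    congr 1
    exact pw_congr fun l _ => (orbit_dependsBelow hp).two_pow_add l
  rw [h1]
  push_cast
  refine if_congr ?_ rfl rfl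
  constructor <;> intro h <;> omega

/-- The counts for all prefix weights sum up to the size of the orbit. -/
theorem orbitCount_add_sum {n a : ℕ} (ha : a ≤ 2 ^ n) {f : Finset ℕ} (hf : f ⊆ range n) :
    orbitCount n f 0 a + ∑ v ∈ range (2 ^ (n - f.card)), orbitCount n f ((v : ℤ) + 1) a =
      (orbit n f).card := by
  have h : ∀ p ∈ orbit n f, pw a p ∈ range (2 ^ (n - f.card) + 1) := fun p hp => by
    have h1 := pw_mono ha p
    rw [pw_orbit hp, filter_lt_eq_self hf] at h1
    rw [mem_range]
    omega
  rw [card_eq_sum_card_fiberwise h, sum_range_succ', add_comm]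
  unfold orbitCount
  congr 1
  · refine sum_congr rfl fun v _ => ?_
    congr 1
    refine filter_congr fun p _ => ?_
    constructor <;> intro h <;> omega
  · congr 1
    refine filter_congr fun p _ => ?_
    constructor <;> intro h <;> omega

/-! ### Translation between words of length 2^m and functions on the natural numbers -/

/-- The set of the variable numbers of a monomial. -/
def support {m : ℕ} (f : Monomial m) : Finset ℕ := f.map Fin.valEmbedding

/-- The first `2 ^ m` values of a function. -/
def toWord (m : ℕ) (q : ℕ → ZMod 2) : Word m := fun l => q l.val

theorem support_subset {m : ℕ} (f : Monomial m) : support f ⊆ range m := fun k hk => by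
  obtain ⟨l, _, rfl⟩ := mem_map.1 hk
  exact mem_range.2 l.isLt

theorem support_injective {m : ℕ} : Function.Injective (support (m := m)) := map_injective _

@[simp] theorem card_support {m : ℕ} (f : Monomial m) : (support f).card = f.card := card_map _

theorem mem_support {m : ℕ} {f : Monomial m} {k : Fin m} : k.val ∈ support f ↔ k ∈ f :=
  mem_map' Fin.valEmbedding

theorem exists_support_eq {m : ℕ} {g : Finset ℕ} (hg : g ⊆ range m) :
    ∃ f : Monomial m, support f = g := by
  refine ⟨univ.filter fun k : Fin m => k.val ∈ g, ?_⟩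
  ext k
  simp only [support, mem_map, mem_filter, mem_univ, true_and, Fin.valEmbedding_apply]
  constructor
  · rintro ⟨l, hl, rfl⟩; exact hl
  · intro h; exact ⟨⟨k, mem_range.1 (hg h)⟩, h, rfl⟩

theorem evMon_eq {m : ℕ} (f : Monomial m) : evMon f = toWord m (mon (support f)) := by
  funext l
  simp only [evMon, toWord, mon, support, Finset.prod_apply, prod_map]
  rfl

theorem index_add_binVal {m : ℕ} (f : Monomial m) : index f + binVal (support f) = 2 ^ m := by
  have h1 : binVal (support f) = ∑ k : Fin m, if k ∈ f then 2 ^ k.val else 0 := by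
    rw [← sum_filter, binVal, support, sum_map]
    simp
  have h2 : ∑ k : Fin m, 2 ^ k.val = 2 ^ m - 1 := by
    rw [Fin.sum_univ_eq_sum_range (fun k => 2 ^ k) m, Nat.geomSum_eq le_rfl]
    simp
  have h3 : ∑ k : Fin m, (if k ∈ f then 0 else 2 ^ k.val) +
      ∑ k : Fin m, (if k ∈ f then 2 ^ k.val else 0) = 2 ^ m - 1 := by
    rw [← sum_add_distrib, ← h2]
    refine sum_congr rfl fun k _ => ?_
    split_ifs <;> simp
  have h4 : 0 < 2 ^ m := by positivity
  rw [index, h1]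
  omega

theorem index_lt_index {m : ℕ} {f g : Monomial m} :
    index g < index f ↔ binVal (support f) < binVal (support g) := by
  have := index_add_binVal f
  have := index_add_binVal g
  omega

theorem zmod2_val_eq_ite (z : ZMod 2) : z.val = if z ≠ 0 then 1 else 0 := by revert z; decide

theorem hammingNorm_toWord (m : ℕ) (q : ℕ → ZMod 2) : hammingNorm (toWord m q) = pw (2 ^ m) q := by
  rw [hammingNorm, card_filter, pw, ← Fin.sum_univ_eq_sum_range (fun l => (q l).val)]
  exact sum_congr rfl fun l _ => (zmod2_val_eq_ite _).symm

theorem prefixWeight_toWord {m a : ℕ} (ha : a ≤ 2 ^ m) (q : ℕ → ZMod 2) :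
    prefixWeight a (toWord m q) = pw a q := by
  have h1 : pw a q = ∑ l ∈ range (2 ^ m), if l < a then (q l).val else 0 := by
    rw [← sum_filter, pw]
    refine sum_congr ?_ fun _ _ => rfl
    ext l
    simp only [mem_range, mem_filter]
    omega
  rw [h1, ← Fin.sum_univ_eq_sum_range (fun l => if l < a then (q l).val else 0), prefixWeight,
    card_filter]
  refine sum_congr rfl fun l _ => ?_
  rw [zmod2_val_eq_ite]
  simp only [toWord, Nat.lt_iff_add_one_le]
  split_ifs <;> simp_all

theorem mem_qup {m i : ℕ} {l : Fin (2 ^ m)} : l ∈ qup m i ↔ l.val < i := by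
  simp only [qup, mem_filter, mem_univ, true_and]
  omega

theorem hammingNorm_puncture (m i : ℕ) (q : ℕ → ZMod 2) :
    hammingNorm (puncture (qup m i) (toWord m q)) = sw m i q := by
  have h1 : sw m i q = ∑ l ∈ range (2 ^ m), if i ≤ l then (q l).val else 0 := by
    rw [← sum_filter, sw]
    refine sum_congr ?_ fun _ _ => rfl
    ext l
    simp only [mem_range, mem_filter, mem_Ico]
    omega
  rw [h1, ← Fin.sum_univ_eq_sum_range (fun l => if i ≤ l then (q l).val else 0), ← sum_filter,
    hammingNorm, card_filter]
  rw [sum_subtype (univ.filter fun l : Fin (2 ^ m) => i ≤ l.val) (p := fun l => l ∉ qup m i)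
    (fun l => by simp [mem_qup])]
  exact sum_congr rfl fun l _ => (zmod2_val_eq_ite _).symm

/-! ### Codewords as polynomials -/

/-- The monomials of an information set, as sets of variable numbers. -/
def supports {m : ℕ} (I : Finset (Monomial m)) : Finset (Finset ℕ) := I.image support

theorem mem_supports {m : ℕ} {I : Finset (Monomial m)} {f : Monomial m} :
    support f ∈ supports I ↔ f ∈ I := by
  rw [supports, mem_image]
  exact ⟨fun ⟨g, hg, e⟩ => support_injective e ▸ hg, fun h => ⟨f, h, rfl⟩⟩

theorem supports_subset_range {m : ℕ} {I : Finset (Monomial m)} :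
    ∀ g ∈ supports I, g ⊆ range m := fun g hg => by
  obtain ⟨f, _, rfl⟩ := mem_image.1 hg
  exact support_subset f

theorem toWord_add (m : ℕ) (p q : ℕ → ZMod 2) : toWord m (p + q) = toWord m p + toWord m q := rfl

theorem toWord_poly (m : ℕ) (S : Finset (Finset ℕ)) :
    toWord m (poly S) = ∑ g ∈ S, toWord m (mon g) := by
  funext l
  simp [toWord, poly]

theorem mem_code {m : ℕ} {I : Finset (Monomial m)} {c : Word m} :
    c ∈ code I ↔ ∃ S ⊆ supports I, c = toWord m (poly S) := by
  constructor
  · intro h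
    refine Submodule.span_induction ?_ ⟨∅, by simp, ?_⟩ ?_ ?_ h
    · rintro _ ⟨f, hf, rfl⟩
      exact ⟨{support f}, by simpa [mem_supports] using hf, by simp [evMon_eq, poly]⟩
    · funext l; simp [toWord]
    · rintro _ _ _ _ ⟨S, hS, rfl⟩ ⟨S', hS', rfl⟩
      refine ⟨symmDiff S S', fun g hg => ?_, by rw [poly_symmDiff, toWord_add]⟩
      rcases mem_symmDiff.1 hg with h | h
      · exact hS h.1
      · exact hS' h.1
    · rintro a _ _ ⟨S, hS, rfl⟩
      rcases zmod2_cases a with rfl | rfl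
      · exact ⟨∅, by simp, by funext l; simp [toWord]⟩
      · exact ⟨S, hS, by simp⟩
  · rintro ⟨S, hS, rfl⟩
    rw [toWord_poly]
    refine sum_mem fun g hg => ?_
    obtain ⟨f, hf, rfl⟩ := mem_image.1 (hS hg)
    rw [← evMon_eq]
    exact Submodule.subset_span ⟨f, hf, rfl⟩

theorem ev_eq {m : ℕ} (u : Monomial m → ZMod 2) :
    ev u = toWord m (poly (supports (univ.filter fun g => u g = 1))) := by
  rw [toWord_poly, supports, sum_image fun _ _ _ _ h => support_injective h, sum_filter]
  funext l
  rw [Finset.sum_apply]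
  refine sum_congr rfl fun g _ => ?_
  rw [evMon_eq]
  rcases zmod2_cases (u g) with h | h <;> simp [h]

theorem mon_mem_orbit {n : ℕ} {f : Finset ℕ} (hf : f ⊆ range n) : mon f ∈ orbit n f := by
  induction n generalizing f with
  | zero =>
    have : f = ∅ := by simpa using hf
    simp [this, orbit, mon]
  | succ n ih =>
    by_cases hn : n ∈ f
    · refine (mem_orbit_succ hn).2 ⟨0, zero_mem_polys _ _, mon (f.erase n), ?_, ?_⟩
      · rw [orbit_congr (f' := f.erase n) fun k hk => by simp [hk.ne]]
        exact ih (subset_range_of_succ ((erase_subset n f).trans hf) (by simp))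
      · rw [add_zero]
        exact (mul_prod_erase f var hn).symm
    · rw [orbit_succ_of_notMem hn]
      exact ih (subset_range_of_succ hf hn)

theorem hammingNorm_evMon {m : ℕ} (f : Monomial m) : hammingNorm (evMon f) = 2 ^ (m - f.card) := by
  rw [evMon_eq, hammingNorm_toWord, pw_orbit (mon_mem_orbit (support_subset f)),
    filter_lt_eq_self (support_subset f), card_support]

theorem mem_T {m : ℕ} {I : Finset (Monomial m)} {f : Monomial m} {p : Word m} :
    p ∈ T I f ↔ ∃ S ⊆ supports I, support f ∈ S ∧ (∀ g ∈ S, binVal g ≤ binVal (support f)) ∧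
      p = toWord m (poly S) ∧ pw (2 ^ m) (poly S) = 2 ^ (m - f.card) := by
  constructor
  · rintro ⟨u, h1, h2, h3, rfl, h4⟩
    have hm : ∀ g, support g ∈ supports (univ.filter fun g => u g = 1) ↔ u g = 1 := fun g => by
      rw [mem_supports]; simp
    rw [ev_eq, hammingNorm_toWord, hammingNorm_evMon] at h4
    refine ⟨_, fun g hg => ?_, (hm f).2 h2, fun g hg => ?_, ev_eq u, h4⟩
    · obtain ⟨g', _, rfl⟩ := mem_image.1 hg
      rw [hm] at hg
      rw [mem_supports]
      by_contra h
      rw [h3 g' h] at hg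
      exact zero_ne_one hg
    · obtain ⟨g', _, rfl⟩ := mem_image.1 hg
      rw [hm] at hg
      by_contra h
      rw [h1 g' (index_lt_index.2 (not_le.1 h))] at hg
      exact zero_ne_one hg
  · rintro ⟨S, h1, h2, h3, rfl, h4⟩
    have he : ev (fun g : Monomial m => if support g ∈ S then 1 else 0) = toWord m (poly S) := by
      rw [ev_eq]
      congr 2
      ext g
      constructor
      · intro h
        obtain ⟨g', hg', rfl⟩ := mem_image.1 h
        by_contra h'
        simp [h'] at hg'
      · intro h
        obtain ⟨g', _, rfl⟩ := mem_image.1 (h1 h)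
        rw [mem_supports]
        simp [h]
    refine ⟨_, fun g hg => ?_, if_pos h2, fun g hg => ?_, he.symm, ?_⟩
    · refine if_neg fun h => ?_
      have := h3 _ h
      have := index_lt_index.1 hg
      omega
    · exact if_neg fun h => hg (mem_supports.1 (h1 h))
    · rw [hammingNorm_toWord, hammingNorm_evMon, h4]

/-- Puncturing is injective on the code. -/
theorem eq_of_puncture_eq {m i : ℕ} {I : Finset (Monomial m)} (hX : ∀ f ∈ I, i < index f)
    {S S' : Finset (Finset ℕ)} (hS : S ⊆ supports I) (hS' : S' ⊆ supports I)
    (h : puncture (qup m i) (toWord m (poly S)) = puncture (qup m i) (toWord m (poly S'))) :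
    S = S' := by
  by_contra hne
  have hsub : ∀ g ∈ symmDiff S S', g ∈ supports I := fun g hg => by
    rcases mem_symmDiff.1 hg with h | h
    · exact hS h.1
    · exact hS' h.1
  have hpos := sw_poly_pos (n := m) (i := i) (fun g hg => supports_subset_range g (hsub g hg))
    (nonempty_iff_ne_empty.2 fun h => hne (symmDiff_eq_bot.1 h)) fun g hg => by
      obtain ⟨f, hf, rfl⟩ := mem_image.1 (hsub g hg)
      have := hX f hf
      have := index_add_binVal f
      omega
  rw [poly_symmDiff, ← hammingNorm_puncture, toWord_add] at hpos
  have h0 : puncture (qup m i) (toWord m (poly S) + toWord m (poly S')) = 0 := funext fun l => by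
    have := congrFun h l
    simp only [puncture] at this
    simp only [puncture, Pi.add_apply, this, CharTwo.add_self_eq_zero, Pi.zero_apply]
  rw [h0, hammingNorm_zero] at hpos
  exact lt_irrefl _ hpos

/-! ### The partial order -/

/-- The factor of g consists of its largest variables, as many as f has. If the l-th variable of f
exceeded the corresponding one, f would have more variables from there on than g. -/
theorem precedes_of_dominated {m : ℕ} {f g : Monomial m} (h : Dominated (support f) (support g)) :
    Precedes f g := by
  have hd : ∀ x : Fin m, (f.filter fun k => x ≤ k).card ≤ (g.filter fun k => x ≤ k).card := by
    intro x
    have := h x.val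
    simp only [support, filter_map, card_map] at this
    exact this
  have hc : f.card ≤ g.card := by
    have := h 0
    simpa [card_support] using this
  set e := g.card - f.card with he
  have hlt : ∀ l : Fin f.card, e + l.val < g.card := fun l => by omega
  set F : Fin f.card → Fin m := fun l => g.orderEmbOfFin rfl ⟨e + l.val, hlt l⟩ with hF
  have hmono : StrictMono F := fun a b hab =>
    (g.orderEmbOfFin rfl).strictMono (by
      have : a.val < b.val := hab
      exact Fin.mk_lt_mk.2 (by omega))
  have hcard : (univ.image F).card = f.card := by
    rw [card_image_of_injective _ hmono.injective, card_univ, Fintype.card_fin]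
  refine ⟨univ.image F, fun k hk => ?_, hcard, fun l => ?_⟩
  · obtain ⟨l, _, rfl⟩ := mem_image.1 hk
    exact orderEmbOfFin_mem g rfl _
  · have hu := orderEmbOfFin_unique hcard (fun l => mem_image_of_mem F (mem_univ l)) hmono
    rw [← hu]
    by_contra hlt'
    rw [not_le] at hlt'
    have h1 : f.card - l.val ≤ (f.filter fun k => f.orderEmbOfFin rfl l ≤ k).card := by
      have : (Ici l).image (f.orderEmbOfFin rfl) ⊆ f.filter fun k => f.orderEmbOfFin rfl l ≤ k := by
        intro k hk
        obtain ⟨l', hl', rfl⟩ := mem_image.1 hk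
        exact mem_filter.2 ⟨orderEmbOfFin_mem f rfl _,
          (f.orderEmbOfFin rfl).monotone (mem_Ici.1 hl')⟩
      have := card_le_card this
      rwa [card_image_of_injective _ (f.orderEmbOfFin rfl).injective, Fin.card_Ici] at this
    have h2 : (g.filter fun k => f.orderEmbOfFin rfl l ≤ k).card ≤ g.card - 1 - (e + l.val) := by
      have : (g.filter fun k => f.orderEmbOfFin rfl l ≤ k) ⊆
          (Ioi (⟨e + l.val, hlt l⟩ : Fin g.card)).image (g.orderEmbOfFin rfl) := by
        intro k hk
        obtain ⟨hk1, hk2⟩ := mem_filter.1 hk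
        have hk3 : k ∈ Set.range (g.orderEmbOfFin rfl) := by
          rw [range_orderEmbOfFin]; exact hk1
        obtain ⟨l', rfl⟩ := hk3
        refine mem_image_of_mem _ (mem_Ioi.2 ?_)
        exact (g.orderEmbOfFin rfl).lt_iff_lt.1 (hlt'.trans_le hk2)
      have := card_le_card this
      rwa [card_image_of_injective _ (g.orderEmbOfFin rfl).injective, Fin.card_Ioi] at this
    have h3 := hd (f.orderEmbOfFin rfl l)
    have := hlt l
    omega

/-- The degree condition puts words of T(f) into the orbit; decreasingness puts the orbit into the
code. -/
theorem T_eq_orbit {m : ℕ} {I : Finset (Monomial m)} (hI : IsDecreasing I) {f : Monomial m}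
    (hf : f ∈ I) (hdeg : ∀ g ∈ I, index f < index g → g.card ≤ f.card) :
    T I f = toWord m '' (orbit m (support f) : Set (ℕ → ZMod 2)) := by
  ext p
  rw [mem_T]
  constructor
  · rintro ⟨S, h1, h2, h3, rfl, h4⟩
    refine ⟨poly S, ?_, rfl⟩
    refine poly_mem_orbit (fun g hg => supports_subset_range g (h1 hg)) h2 h3 (fun g hg => ?_)
      (by rw [h4, card_support])
    obtain ⟨g', hg', rfl⟩ := mem_image.1 (h1 hg)
    rw [card_support, card_support]
    rcases (h3 _ hg).lt_or_eq with h | h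
    · exact hdeg g' hg' (index_lt_index.2 h)
    · rw [support_injective (binVal_injective h)]
  · rintro ⟨q, hq, rfl⟩
    obtain ⟨S, h1, h2, rfl⟩ := orbit_expansion (support_subset f) hq
    refine ⟨S, fun g hg => ?_, h1, fun g hg => (h2 g hg).2.2, rfl, ?_⟩
    · obtain ⟨g', rfl⟩ := exists_support_eq (h2 g hg).1
      exact mem_supports.2 (hI _ _ (precedes_of_dominated (h2 _ hg).2.1) hf)
    · rw [pw_orbit hq, filter_lt_eq_self (support_subset f), card_support]

theorem isDecreasing_card_le (m t : ℕ) :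
    IsDecreasing (univ.filter fun g : Monomial m => g.card ≤ t) := fun f g h hg => by
  obtain ⟨g', h1, h2, _⟩ := h
  have := card_le_card h1
  simp only [mem_filter, mem_univ, true_and] at hg ⊢
  omega

theorem toWord_injOn (m : ℕ) (f : Finset ℕ) :
    Set.InjOn (toWord m) (orbit m f : Set (ℕ → ZMod 2)) := fun _ hp _ hq h =>
  (orbit_dependsBelow hp).ext (orbit_dependsBelow hq) fun l hl => congrFun h ⟨l, hl⟩

/-- Puncturing is injective on T(f), and the total weight is constant there, so punctured weight w
means prefix weight 2^(m - deg f) - w. -/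
theorem P_eq_orbitCount {m i : ℕ} {I : Finset (Monomial m)} (hI : IsDecreasing I)
    (hX : ∀ f ∈ I, i < index f) {f : Monomial m} (hf : f ∈ I)
    (hdeg : ∀ g ∈ I, index f < index g → g.card ≤ f.card) (w : ℕ) :
    P I f w i = orbitCount m (support f) (2 ^ (m - f.card) - (w : ℤ)) i := by
  have hi : i ≤ 2 ^ m := by
    have := hX f hf
    have := index_add_binVal f
    omega
  have hinj : Set.InjOn (fun q => puncture (qup m i) (toWord m q))
      (orbit m (support f) : Set (ℕ → ZMod 2)) := fun p hp q hq h => by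
    have h1 : toWord m p ∈ T I f := by rw [T_eq_orbit hI hf hdeg]; exact ⟨p, hp, rfl⟩
    have h2 : toWord m q ∈ T I f := by rw [T_eq_orbit hI hf hdeg]; exact ⟨q, hq, rfl⟩
    obtain ⟨S, hS, _, _, e, _⟩ := mem_T.1 h1
    obtain ⟨S', hS', _, _, e', _⟩ := mem_T.1 h2
    simp only [e, e'] at h
    have := eq_of_puncture_eq hX hS hS' h
    exact toWord_injOn m _ hp hq (by rw [e, e', this])
  have hset : {c | c ∈ puncturedT I f (qup m i) ∧ hammingNorm c = w} =
      (fun q => puncture (qup m i) (toWord m q)) ''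
        (((orbit m (support f)).filter fun p => (pw i p : ℤ) = 2 ^ (m - f.card) - (w : ℤ) :
          Finset _) : Set (ℕ → ZMod 2)) := by
    have key : ∀ q ∈ orbit m (support f), hammingNorm (puncture (qup m i) (toWord m q)) = w ↔
        (pw i q : ℤ) = 2 ^ (m - f.card) - (w : ℤ) := fun q hq => by
      have h1 := pw_add_sw hi q
      rw [pw_orbit hq, filter_lt_eq_self (support_subset f), card_support] at h1
      have h2 : (pw i q : ℤ) + sw m i q = 2 ^ (m - f.card) := by exact_mod_cast h1
      rw [hammingNorm_puncture]
      constructor <;> intro h <;> omega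
    ext c
    simp only [puncturedT, T_eq_orbit hI hf hdeg, Set.mem_ofPred_eq, Set.mem_image, mem_coe,
      coe_filter]
    constructor
    · rintro ⟨⟨_, ⟨q, hq, rfl⟩, rfl⟩, hc⟩
      exact ⟨q, ⟨hq, (key q hq).1 hc⟩, rfl⟩
    · rintro ⟨q, ⟨hq, h⟩, rfl⟩
      exact ⟨⟨_, ⟨q, hq, rfl⟩, rfl⟩, (key q hq).2 h⟩
  rw [P, numWeight, hset, (hinj.mono (coe_subset.2 (filter_subset _ _))).ncard_image,
    Set.ncard_coe_finset, orbitCount]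

/-! ### The recursion -/

theorem lam_eq_card_orbit {m : ℕ} (f : Monomial m) : lam f = (orbit m (support f)).card := by
  rw [card_orbit, lam, filter_lt_eq_self (support_subset f)]
  congr 1
  have h1 : ∀ l : Fin f.card,
      ((support f).filter (· < (f.orderEmbOfFin rfl l).val)).card = l.val := fun l => by
    have : (support f).filter (· < (f.orderEmbOfFin rfl l).val) =
        (Iio l).image fun l' => (f.orderEmbOfFin rfl l').val := by
      ext k
      simp only [mem_filter, mem_image, mem_Iio, support, mem_map, Fin.valEmbedding_apply]
      constructor
      · rintro ⟨⟨k', hk', rfl⟩, h⟩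
        have hk3 : k' ∈ Set.range (f.orderEmbOfFin rfl) := by
          rw [range_orderEmbOfFin]; exact hk'
        obtain ⟨l', rfl⟩ := hk3
        exact ⟨l', (f.orderEmbOfFin rfl).lt_iff_lt.1 h, rfl⟩
      · rintro ⟨l', hl', rfl⟩
        exact ⟨⟨_, orderEmbOfFin_mem f rfl l', rfl⟩, (f.orderEmbOfFin rfl).lt_iff_lt.2 hl'⟩
    rw [this, card_image_of_injective, Fin.card_Iio]
    exact Fin.val_injective.comp (f.orderEmbOfFin rfl).injective
  have h2 : ∀ G : ℕ → ℕ, ∑ k ∈ support f, G k =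
      ∑ l : Fin f.card, G (f.orderEmbOfFin rfl l).val := fun G => by
    rw [support, sum_map]
    conv_lhs => rw [← image_orderEmbOfFin_univ f rfl]
    rw [sum_image fun _ _ _ _ h => (f.orderEmbOfFin rfl).injective h]
    rfl
  rw [h2]
  exact sum_congr rfl fun l _ => by rw [h1]

theorem support_insert {m : ℕ} (s : Fin m) (f : Monomial m) :
    support (insert s f) = insert s.val (support f) := map_insert _ _ _

theorem support_erase {m : ℕ} (s : Fin m) (f : Monomial m) :
    support (f.erase s) = (support f).erase s.val := map_erase _ _ _

theorem alpha_eq {m : ℕ} (f : Monomial m) (j s : Fin m) :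
    alpha f j s = (((support f).erase j.val).filter fun k => s.val < k).card := by
  rw [alpha, ← support_erase, support, filter_map, card_map]
  rfl

theorem sum_lt_max_notMem {m : ℕ} (f : Monomial m) (j : Fin m) (G : ℕ → ℤ) :
    ∑ s : {s : Fin m // s < j ∧ s ∉ f}, G s.val.val = ∑ s ∈ range j.val \ support f, G s := by
  refine sum_bij (fun s _ => s.val.val) (fun s _ => ?_) (fun s _ s' _ h => ?_) (fun k hk => ?_)
    (fun s _ => rfl)
  · rw [mem_sdiff, mem_range, mem_support]
    exact s.2
  · exact Subtype.ext (Fin.ext h)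
  · rw [mem_sdiff, mem_range] at hk
    exact ⟨⟨⟨k, hk.1.trans j.isLt⟩, hk.1, fun h => hk.2 (mem_support.2 h)⟩, mem_univ _, rfl⟩

/-- The bound on a matters: the search sees 2^m positions only, whereas orbit elements continue
periodically. -/
theorem N_of_card_le_one {m : ℕ} {f : Monomial m} (hf : ¬ 2 ≤ f.card) {a : ℕ} (ha : a ≤ 2 ^ m)
    (w : ℤ) : N f w a = orbitCount m (support f) w a := by
  rw [N, dif_neg hf, T_eq_orbit (isDecreasing_card_le m f.card) (by simp) fun g hg _ => by
    simpa using hg]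
  have hset : {p ∈ toWord m '' (orbit m (support f) : Set (ℕ → ZMod 2)) |
      (prefixWeight a p : ℤ) = w} = toWord m '' (((orbit m (support f)).filter fun p =>
        (pw a p : ℤ) = w : Finset _) : Set (ℕ → ZMod 2)) := by
    ext c
    simp only [Set.mem_ofPred_eq, Set.mem_image, mem_coe, coe_filter]
    constructor
    · rintro ⟨⟨q, hq, rfl⟩, h⟩
      exact ⟨q, ⟨hq, by rwa [prefixWeight_toWord ha] at h⟩, rfl⟩
    · rintro ⟨q, ⟨hq, h⟩, rfl⟩
      exact ⟨⟨q, hq, rfl⟩, by rwa [prefixWeight_toWord ha]⟩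
  rw [hset, ((toWord_injOn m _).mono (coe_subset.2 (filter_subset _ _))).ncard_image,
    Set.ncard_coe_finset, orbitCount]

theorem orbitCount_eq_of_subset {n m : ℕ} {f : Finset ℕ} (hf : f ⊆ range n) (h : n ≤ m) (w : ℤ)
    (a : ℕ) : orbitCount m f w a = orbitCount n f w a := by
  rw [orbitCount, orbitCount, orbit_eq_of_subset hf h]

theorem support_subset_range_max {m : ℕ} {f : Monomial m} (hf : f.Nonempty) :
    support f ⊆ range ((f.max' hf).val + 1) := fun k hk => by
  obtain ⟨l, hl, rfl⟩ := mem_map.1 hk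
  have : l.val ≤ (f.max' hf).val := f.le_max' l hl
  exact mem_range.2 (by simp; omega)

theorem N_eq_orbitCount {m : ℕ} (f : Monomial m) (w : ℤ) {a : ℕ} (ha : a ≤ 2 ^ m) :
    N f w a = orbitCount m (support f) w a := by
  induction hT : top f using Nat.strong_induction_on generalizing f w a with
  | _ T ihT =>
  induction a using Nat.strong_induction_on generalizing w with
  | _ a iha =>
  by_cases hc : 2 ≤ f.card
  swap
  · exact N_of_card_le_one hc ha w
  have hf : f.Nonempty := card_pos.1 (by omega)
  set j := f.max' hf with hj
  have hjf : j ∈ f := f.max'_mem hf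
  have hr : support f ⊆ range (j.val + 1) := support_subset_range_max hf
  have hjm : j.val + 1 ≤ m := j.isLt
  have hre : (support f).erase j.val ⊆ range (j.val + 1) := (erase_subset _ _).trans hr
  have hpow : 2 ^ (j.val + 1) = 2 * 2 ^ j.val := by ring
  -- Nonzero weights are settled first, because the case w = 0 subtracts the counts for them at the
  -- same f and a.
  have hne : ∀ w : ℤ, w ≠ 0 → a ≤ 2 ^ j.val → N f w a = orbitCount m (support f) w a := by
    intro w hw ha'
    rw [N, dif_pos hc]
    simp only [← hj]
    rw [if_pos ha', if_neg hw, orbitCount_eq_of_subset hr hjm,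
      orbitCount_of_le_half hr (mem_support.2 hjf) ha' hw]
    push_cast
    congr 1
    · rw [← sum_lt_max_notMem f j fun s => 2 ^ (((support f).erase j.val).filter
        fun k => s < k).card * (orbitCount (j.val + 1) (insert s ((support f).erase j.val)) w a : ℤ)]
      refine sum_congr rfl fun s _ => ?_
      rw [ihT _ (hT ▸ sup_insert_erase_lt f hf s.val s.2.1) _ _ ha rfl, alpha_eq, support_insert,
        support_erase, orbitCount_eq_of_subset (insert_subset _ hre) hjm]
      have : s.val.val < j.val := s.2.1
      exact mem_range.2 (by omega)
    · rw [ihT _ (hT ▸ sup_erase_lt f hf) _ _ ha rfl, support_erase,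
        orbitCount_eq_of_subset hre hjm]
  rcases le_or_gt a (2 ^ j.val) with h1 | h1
  · by_cases hw : w = 0
    · subst hw
      have hsum := orbitCount_add_sum ha (support_subset f)
      rw [N, dif_pos hc]
      simp only [← hj]
      rw [if_pos h1, if_pos trivial, lam_eq_card_orbit, ← hsum, card_support,
        sum_congr rfl fun v _ => hne _ (by omega) h1]
      push_cast
      ring
    · exact hne w hw h1
  · have hc' : (support f).card = f.card := card_support f
    rcases le_or_gt a (2 ^ (j.val + 1)) with h2 | h2
    · rw [N, dif_pos hc]
      simp only [← hj]
      rw [if_neg (by omega), if_pos h2, iha _ (by omega) _ (by omega),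
        orbitCount_eq_of_subset hr hjm, orbitCount_eq_of_subset hr hjm,
        orbitCount_reversal h2 hr w, card_support]
    · rw [N, dif_pos hc]
      simp only [← hj]
      have hpos : 0 < 2 ^ (j.val + 1) := by positivity
      rw [if_neg (by omega), if_neg (by omega), iha _ (by omega) _ (by omega),
        orbitCount_eq_of_subset hr hjm, orbitCount_eq_of_subset hr hjm]
      conv_rhs => rw [← Nat.add_sub_cancel' h2.le, orbitCount_two_pow_add _ _ hr, card_support]

/-! ### The punctured code and its minimum words -/

theorem mem_puncturedCode {m : ℕ} {I : Finset (Monomial m)} {X : Finset (Fin (2 ^ m))}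
    {c : {l // l ∉ X} → ZMod 2} :
    c ∈ puncturedCode I X ↔ ∃ S ⊆ supports I, c = puncture X (toWord m (poly S)) := by
  constructor
  · rintro ⟨p, hp, rfl⟩
    obtain ⟨S, hS, rfl⟩ := mem_code.1 hp
    exact ⟨S, hS, rfl⟩
  · rintro ⟨S, hS, rfl⟩
    exact ⟨_, mem_code.2 ⟨S, hS, rfl⟩, rfl⟩

theorem puncturedT_subset {m : ℕ} (I : Finset (Monomial m)) (f : Monomial m)
    (X : Finset (Fin (2 ^ m))) : puncturedT I f X ⊆ puncturedCode I X := by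
  rintro _ ⟨p, hp, rfl⟩
  obtain ⟨S, hS, _, _, rfl, _⟩ := mem_T.1 hp
  exact mem_puncturedCode.2 ⟨S, hS, rfl⟩

/-- Different monomials have disjoint sets `T_P`. -/
theorem puncturedT_unique {m i : ℕ} {I : Finset (Monomial m)} (hX : ∀ f ∈ I, i < index f)
    {f f' : Monomial m} {c : {l // l ∉ qup m i} → ZMod 2} (h : c ∈ puncturedT I f (qup m i))
    (h' : c ∈ puncturedT I f' (qup m i)) : f = f' := by
  obtain ⟨p, hp, rfl⟩ := h
  obtain ⟨p', hp', e⟩ := h'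
  obtain ⟨S, h1, h2, h3, rfl, _⟩ := mem_T.1 hp
  obtain ⟨S', h1', h2', h3', rfl, _⟩ := mem_T.1 hp'
  have hS := eq_of_puncture_eq hX h1' h1 e
  subst hS
  exact support_injective (binVal_injective (le_antisymm (h3' _ h2) (h3 _ h2')))

/-- The sum counts a union, since the punctured sets are disjoint. -/
theorem sum_P_eq_card {m i : ℕ} {I : Finset (Monomial m)} (hX : ∀ f ∈ I, i < index f) (w : ℕ) :
    ∑ f ∈ I, P I f w i =
      {c | (∃ f ∈ I, c ∈ puncturedT I f (qup m i)) ∧ hammingNorm c = w}.ncard := by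
  classical
  have h : ∀ f, P I f w i = (univ.filter fun c =>
      c ∈ puncturedT I f (qup m i) ∧ hammingNorm c = w).card := fun f => by
    rw [P, numWeight, ← Set.ncard_coe_finset]
    simp
  rw [sum_congr rfl fun f _ => h f, ← card_biUnion, ← Set.ncard_coe_finset]
  · congr 1
    ext c
    simp only [coe_biUnion, coe_filter, mem_univ, true_and, Set.mem_iUnion, Set.mem_ofPred_eq,
      mem_coe]
    constructor
    · rintro ⟨f, hf, h1, h2⟩; exact ⟨⟨f, hf, h1⟩, h2⟩
    · rintro ⟨⟨f, hf, h1⟩, h2⟩; exact ⟨f, hf, h1, h2⟩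
  · intro f _ f' _ hne
    rw [Function.onFun, Finset.disjoint_left]
    intro c hc hc'
    exact hne (puncturedT_unique hX (mem_filter.1 hc).2.1 (mem_filter.1 hc').2.1)

theorem sum_P_le {m i : ℕ} {I : Finset (Monomial m)} (hX : ∀ f ∈ I, i < index f) (w : ℕ) :
    ∑ f ∈ I, P I f w i ≤ numWeight (puncturedCode I (qup m i)) w := by
  rw [sum_P_eq_card hX]
  refine Set.ncard_le_ncard ?_ (Set.toFinite _)
  rintro c ⟨⟨f, _, hc⟩, hw⟩
  exact ⟨puncturedT_subset I f _ hc, hw⟩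

/-- The minimum weight words of the punctured code come from minimum weight words `T(f)`. -/
theorem exists_minWeight_puncturedCode {m i : ℕ} {I : Finset (Monomial m)} (hne : I.Nonempty)
    (hX : ∀ f ∈ I, i < index f) :
    ∃ d, 0 < d ∧ IsMinWeight (puncturedCode I (qup m i)) d ∧
      ∀ c ∈ puncturedCode I (qup m i), hammingNorm c = d →
        ∃ f ∈ I, c ∈ puncturedT I f (qup m i) := by
  obtain ⟨f0, hf0⟩ := hne
  have hidx : ∀ g ∈ supports I, i + binVal g < 2 ^ m := fun g hg => by
    obtain ⟨f, hf, rfl⟩ := mem_image.1 hg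
    have := hX f hf
    have := index_add_binVal f
    omega
  obtain ⟨S, hS, hmin⟩ := ((supports I).powerset.filter fun S => S.Nonempty).exists_min_image
    (fun S => sw m i (poly S)) ⟨{support f0}, by simpa using mem_supports.2 hf0⟩
  rw [mem_filter, mem_powerset] at hS
  have hmin' : ∀ S' ⊆ supports I, S'.Nonempty → sw m i (poly S) ≤ sw m i (poly S') :=
    fun S' h h' => hmin S' (mem_filter.2 ⟨mem_powerset.2 h, h'⟩)
  have hpos : 0 < sw m i (poly S) := sw_poly_pos (fun g hg => supports_subset_range g (hS.1 hg))
    hS.2 fun g hg => hidx g (hS.1 hg)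
  have hnorm_zero : ∀ c : {l // l ∉ qup m i} → ZMod 2, 0 < hammingNorm c → c ≠ 0 := fun c hc h => by
    rw [h, hammingNorm_zero] at hc
    exact lt_irrefl _ hc
  refine ⟨sw m i (poly S), hpos, ⟨⟨_, mem_puncturedCode.2 ⟨S, hS.1, rfl⟩, hnorm_zero _ ?_,
    hammingNorm_puncture m i _⟩, ?_⟩, ?_⟩
  · rwa [hammingNorm_puncture]
  · rintro _ ⟨c, hc, hc0, rfl⟩
    obtain ⟨S', hS', rfl⟩ := mem_puncturedCode.1 hc
    rw [hammingNorm_puncture]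
    refine hmin' S' hS' (nonempty_iff_ne_empty.2 fun h => hc0 ?_)
    rw [h, poly_empty]
    rfl
  · intro c hc hd
    obtain ⟨S', hS', rfl⟩ := mem_puncturedCode.1 hc
    rw [hammingNorm_puncture] at hd
    have hne' : S'.Nonempty := nonempty_iff_ne_empty.2 fun h => by
      rw [h, poly_empty, sw_zero] at hd
      omega
    obtain ⟨g, hg, hmax⟩ := exists_binVal_max hne'
    obtain ⟨f, hf, rfl⟩ := mem_image.1 (hS' hg)
    refine ⟨f, hf, _, mem_T.2 ⟨S', hS', hg, hmax, rfl, ?_⟩, rfl⟩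
    -- For C = 0 the minimized weight is exactly the punctured weight.
    rw [pw_eq_of_minimal (C := 0) (i := i) supports_subset_range hS' (Or.inr hidx)
      (fun S'' h h' => ?_) hg hmax, card_support]
    have := hmin' S'' h h'
    omega

end QUPPolar

theorem theorem3 (m r i : ℕ) (I : Finset (QUPPolar.Monomial m))
    (hI : QUPPolar.IsDecreasing I) (hr : QUPPolar.HasOrder I r)
    (hX : ∀ f ∈ I, i < QUPPolar.index f) :
    ∃ d : ℕ,
      IsLeast {w : ℕ | 0 < w ∧ 0 < ∑ f ∈ I, QUPPolar.P I f w i} d ∧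
      QUPPolar.IsMinWeight (QUPPolar.puncturedCode I (QUPPolar.qup m i)) d ∧
      (∀ c ∈ QUPPolar.puncturedCode I (QUPPolar.qup m i), hammingNorm c = d →
        ∃ f ∈ I, c ∈ QUPPolar.puncturedT I f (QUPPolar.qup m i)) ∧
      QUPPolar.numWeight (QUPPolar.puncturedCode I (QUPPolar.qup m i)) d =
        ∑ f ∈ I, QUPPolar.P I f d i ∧
      (∀ w : ℕ, d < w →
        ∑ f ∈ I, QUPPolar.P I f w i ≤
          QUPPolar.numWeight (QUPPolar.puncturedCode I (QUPPolar.qup m i)) w) ∧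
      (∀ f ∈ I, (∀ g ∈ I, QUPPolar.index f < QUPPolar.index g → g.card ≤ f.card) →
        ∀ w : ℕ, (QUPPolar.P I f w i : ℤ) = QUPPolar.N f (2 ^ (m - f.card) - (w : ℤ)) i) := by
  obtain ⟨f0, hf0, _⟩ := hr.1
  obtain ⟨d, hd, hmin, hT⟩ := QUPPolar.exists_minWeight_puncturedCode ⟨f0, hf0⟩ hX
  refine ⟨d, ⟨⟨hd, ?_⟩, ?_⟩, hmin, hT, le_antisymm ?_ (QUPPolar.sum_P_le hX d),
    fun w _ => QUPPolar.sum_P_le hX w, fun f hf hdeg w => ?_⟩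
  · rw [QUPPolar.sum_P_eq_card hX, Set.ncard_pos (Set.toFinite _)]
    obtain ⟨c, hc, _, hw⟩ := hmin.1
    exact ⟨c, hT c hc hw, hw⟩
  · rintro w ⟨hw, hw'⟩
    rw [QUPPolar.sum_P_eq_card hX, Set.ncard_pos (Set.toFinite _)] at hw'
    obtain ⟨c, ⟨f, _, hc⟩, rfl⟩ := hw'
    refine hmin.2 ⟨c, QUPPolar.puncturedT_subset I f _ hc, fun h => ?_, rfl⟩
    rw [h, hammingNorm_zero] at hw
    exact lt_irrefl _ hw
  · rw [QUPPolar.sum_P_eq_card hX]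
    refine Set.ncard_le_ncard ?_ (Set.toFinite _)
    rintro c ⟨hc, hw⟩
    exact ⟨hT c hc hw, hw⟩
  · have hi : i ≤ 2 ^ m := by
      have := hX f hf
      have := QUPPolar.index_add_binVal f
      omega
    rw [QUPPolar.P_eq_orbitCount hI hX hf hdeg, QUPPolar.N_eq_orbitCount f _ hi]
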